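/- Consider the four string diagrams on nodes $0,\dots,4$ with node labels $$(a)\ (1,2,2,4,4),\qquad (b)\ (1,2,2,1,1),\qquad (c)\ (2,1,1,2,2),\qquad (d)\ (4,2,2,1,1),$$ which encode the four basic systems of the crystallographic Coxeter group $G=[4,3,4,3]$. For a diagram with labels $a_0,\dots,a_4$, let $r_0,\dots,r_4\in GL_5(\mathbb Z)$ be the reflections $r_i(b_j)=b_j+m_{ij}b_i$ on $\bigoplus_j\mathbb Z b_j$, where $m_{ii}=-2$, $m_{ij}=\max(1,a_j/a_i)$ if $|i-j|=1$, and $m_{ij}=0$ if $|i-j|\ge 2$; let $G=\langle r_0,\dots,r_4\rangle$, and for an integer $d\geq 2$ let $G^d=\langle r_0,\dots,r_4\rangle^d\subseteq GL_5(\mathbb Z_d)$ be its reduction modulo $d$. A group with distinguished generators $\rho_0,\dots,\rho_{n-1}$ is a string C-group if the $\rho_i$ are involutions, $\rho_i$ and $\rho_j$ commute for $|i-j|\ge2$, and $\langle\rho_i: i\in I\rangle\cap\langle\rho_i: i\in J\rangle=\langle\rho_i: i\in I\cap J\rangle$ for all $I,J\subseteq\{0,\dots,n-1\}$. For a group $\Gamma$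 with distinguished generators $\rho_0,\dots,\rho_{n-1}$, let $\mathcal P(\Gamma)$ be the set whose faces of rank $j$ ($-1\le j\le n$) are the left cosets of $\langle\rho_i: i\ne j\rangle$, a face of rank $j$ being below a face of rank $k$ if and only if $j\le k$ and the two cosets meet. For $\mathbf q\in\mathbb Z^3$, the cubic toroid $\{4,3,4\}_{\mathbf q}$ is the quotient of the tessellation of $3$-space by unit cubes with vertex set $\mathbb Z^3$ by the group of translations generated by $\mathbf q$ and all its images under permutations and sign changes of the coordinates (with a least and a greatest face adjoined), and $\{3,4,3\}$ is the $24$-cell, that is, $\mathcal P$ of the Coxeter group $[3,4,3]$ of type $F_4$ with its standard generators. Let $d>2$. Then for each of the four diagrams the following hold. 1. $G^d$, with the generators $r_0,\dots,r_4$ modulo $d$, is a string C-group. 2. $\mathcal P(G^d)$ is a finite abstract regular $5$-polytope, and $G^d$, acting by left multiplication on cosets, is its full automorphism group. 3. $\mathcal P(G^d)$ is locally toroidal of type $\{\{4,3,4\}_{\mathbf q},\{3,4,3\}\}$, that is, all its facets are isomorphic to $\{4,3,4\}_{\mathbf q}$ and all its vertex-figures are isomorphic to $\{3,4,3\}$,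 where $\mathbf q=(d,d,0)$ for diagram $(d)$ with $d$ even, and $\mathbf q=(d,0,0)$ in all other cases. Moreover, if $d$ is odd, then the groups $G^d$ for any two of the four diagrams are isomorphic; indeed they are conjugate in $GL_5(\mathbb Z_d)$ by an element that carries each generator $r_i$ of one to the generator $r_i$ of the other. -/

import Mathlib

/-! ### Abstract polytopes -/

/-- Two flags (maximal chains) are adjacent if they differ in exactly one face. -/
def flagGraph (P : Type*) [LE P] : SimpleGraph (Flag P) where
  Adj Φ Ψ := ((Φ : Set P) \ (Ψ : Set P)).ncard = 1 ∧ ((Ψ : Set P) \ (Φ : Set P)).ncard = 1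
  symm := ⟨fun _ _ h => ⟨h.2, h.1⟩⟩
  loopless := ⟨fun Φ h => by simp at h⟩

/-- `P`, with the rank function `rk`, is an abstract `n`-polytope. -/
structure IsAbstractPolytope (n : ℕ) (P : Type*) [LE P] (rk : P → ℤ) : Prop where
  partialOrder : IsPartialOrder P (fun F G => F ≤ G)
  rk_strictMono : ∀ F G : P, F ≤ G → F ≠ G → rk F < rk G
  rk_range : Set.range rk = Set.Icc (-1) (n : ℤ)
  least : ∃ F : P, rk F = -1 ∧ ∀ G : P, F ≤ G
  greatest : ∃ F : P, rk F = n ∧ ∀ G : P, G ≤ F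
  flag_card : ∀ Φ : Flag P, (Φ : Set P).ncard = n + 2
  /-- homogeneity (the diamond condition) -/
  diamond : ∀ F G : P, F ≤ G → rk G = rk F + 2 →
    {H : P | F ≤ H ∧ H ≤ G ∧ rk H = rk F + 1}.ncard = 2
  /-- strong flag-connectedness: the flag graph of every section `G/F` is connected -/
  connected : ∀ F G : P, F ≤ G → (flagGraph {H : P // F ≤ H ∧ H ≤ G}).Connected

/-- An abstract polytope is regular if its automorphism group is transitive on flags. -/
structure IsRegularPolytope (n : ℕ) (P : Type*) [LE P] (rk : P → ℤ) : Prop extends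
    IsAbstractPolytope n P rk where
  flag_transitive : ∀ Φ Ψ : Flag P, ∃ f : P ≃o P, f '' (Φ : Set P) = (Ψ : Set P)

/-- All facets of the `n`-polytope `P` are isomorphic to `P₁` and all its vertex-figures are
isomorphic to `P₂`. -/
def HasFacetsAndVertexFigures (n : ℕ) (P : Type*) [LE P] (rk : P → ℤ)
    (P₁ P₂ : Type*) [LE P₁] [LE P₂] : Prop :=
  (∀ F : P, rk F = (n : ℤ) - 1 → Nonempty ({H : P // H ≤ F} ≃o P₁)) ∧
  (∀ F : P, rk F = 0 → Nonempty ({H : P // F ≤ H} ≃o P₂))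

/-! ### String C-groups and their polytopes -/

/-- The group `Γ` with the distinguished generators `ρ₀, …, ρₙ₋₁` is a string C-group. -/
structure IsStringCGroup {n : ℕ} {Γ : Type*} [Group Γ] (ρ : Fin n → Γ) : Prop where
  generate : Subgroup.closure (Set.range ρ) = ⊤
  involution : ∀ i, orderOf (ρ i) = 2
  commute : ∀ i j : Fin n, (i : ℕ) + 2 ≤ j → Commute (ρ i) (ρ j)
  intersection : ∀ I J : Set (Fin n),
    Subgroup.closure (ρ '' I) ⊓ Subgroup.closure (ρ '' J) = Subgroup.closure (ρ '' (I ∩ J))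

/-- The standard subgroup for faces of rank `j - 1`, generated by all `ρᵢ` with `i ≠ j - 1`.
It is the group generated by all `ρᵢ` for the improper ranks `-1` and `n`. -/
def faceSubgroup {n : ℕ} {Γ : Type*} [Group Γ] (ρ : Fin n → Γ) (j : Fin (n + 2)) : Subgroup Γ :=
  Subgroup.closure (ρ '' {i | (i : ℕ) + 1 ≠ j})

/-- The faces of `𝒫(Γ)`: left cosets of the standard subgroups, tagged by their rank plus `1`. -/
@[ext]
structure CosetFace {n : ℕ} {Γ : Type*} [Group Γ] (ρ : Fin n → Γ) where
  idx : Fin (n + 2)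
  coset : Γ ⧸ faceSubgroup ρ idx

/-- The rank of a face of `𝒫(Γ)`, a number in `{-1, 0, …, n}`. -/
def CosetFace.rk {n : ℕ} {Γ : Type*} [Group Γ] {ρ : Fin n → Γ} (F : CosetFace ρ) : ℤ :=
  (F.idx : ℕ) - 1

/-- Incidence in `𝒫(Γ)`: the ranks are in order and the cosets meet. -/
instance {n : ℕ} {Γ : Type*} [Group Γ] (ρ : Fin n → Γ) : LE (CosetFace ρ) where
  le F G := F.idx ≤ G.idx ∧
    ∃ g : Γ, (g : Γ ⧸ faceSubgroup ρ F.idx) = F.coset ∧ (g : Γ ⧸ faceSubgroup ρ G.idx) = G.coset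

/-- The 24-cell `{3,4,3}`, the polytope of the Coxeter group `[3,4,3]` of type `F₄`. -/
abbrev Cell24 : Type := CosetFace CoxeterMatrix.F₄.simple

/-! ### Cubic toroids -/

/-- A (proper) face of the tessellation of `m`-space by unit cubes with vertex set `ℤᵐ`: the cube
`∏ᵢ [baseᵢ, baseᵢ + εᵢ]`, where `εᵢ = 1` for `i ∈ dirs` and `εᵢ = 0` otherwise. -/
@[ext]
structure CubeCell (m : ℕ) where
  base : Fin m → ℤ
  dirs : Finset (Fin m)

/-- The corner of a cell opposite to `base`. -/
def CubeCell.corner {m : ℕ} (C : CubeCell m) : Fin m → ℤ :=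
  fun i => C.base i + if i ∈ C.dirs then 1 else 0

/-- Inclusion of cells. -/
instance (m : ℕ) : LE (CubeCell m) where
  le C E := E.base ≤ C.base ∧ C.corner ≤ E.corner

/-- The lattice spanned by the vector `q` and all its images under permutations and sign changes
of the coordinates. -/
def typeLattice {m : ℕ} (q : Fin m → ℤ) : AddSubgroup (Fin m → ℤ) :=
  AddSubgroup.closure
    {x | ∃ (σ : Equiv.Perm (Fin m)) (ε : Fin m → ℤˣ), x = fun i => (ε i : ℤ) * q (σ i)}

/-- Equivalence of cells under the translations in the lattice of `q`. -/
def cellSetoid {m : ℕ} (q : Fin m → ℤ) : Setoid (CubeCell m) where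
  r C E := C.dirs = E.dirs ∧ E.base - C.base ∈ typeLattice q
  iseqv :=
    { refl := fun C => ⟨rfl, by simp [(typeLattice q).zero_mem]⟩
      symm := fun {C E} h => ⟨h.1.symm, by
        have := (typeLattice q).neg_mem h.2
        rwa [neg_sub] at this⟩
      trans := fun {C E F} h h' => ⟨h.1.trans h'.1, by
        have := (typeLattice q).add_mem h'.2 h.2
        rwa [sub_add_sub_cancel] at this⟩ }

/-- The proper faces of the cubic toroid `{4,3ᵐ⁻²,4}_q`: translation classes of cells. -/
def ToroidCell {m : ℕ} (q : Fin m → ℤ) : Type := Quotient (cellSetoid q)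

/-- Two classes of cells are incident if they have incident representatives. -/
instance {m : ℕ} (q : Fin m → ℤ) : LE (ToroidCell q) where
  le x y := ∃ C E : CubeCell m,
    Quotient.mk (cellSetoid q) C = x ∧ Quotient.mk (cellSetoid q) E = y ∧ C ≤ E

/-- The cubic toroid `{4,3ᵐ⁻²,4}_q`, with its improper least and greatest faces: the quotient of
the cubical tessellation of `m`-space by the lattice of `q`. -/
abbrev CubicToroid {m : ℕ} (q : Fin m → ℤ) : Type := WithBot (WithTop (ToroidCell q))

/-! ### Crystallographic string Coxeter groups and modular reduction -/

/-- The Cartan integers of the basic system whose string diagram (with single branches between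
consecutive nodes) has the node labels `a j = b_j · b_j`: adjacent nodes `i, j` labelled `a, ka`
(`k ≥ 1`) have `m_{ij} = k` and `m_{ji} = 1`. -/
def cartanInt {n : ℕ} (a : Fin n → ℕ) (i j : Fin n) : ℤ :=
  if i = j then -2
  else if (i : ℕ) + 1 = j ∨ (j : ℕ) + 1 = i then ((max 1 (a j / a i) : ℕ) : ℤ)
  else 0

/-- The matrix, in the basis `b_0, …, b_{n-1}`, of the reflection `r_i(b_j) = b_j + m_{ij} b_i`. -/
def reflMatrix {n : ℕ} (a : Fin n → ℕ) (i : Fin n) : Matrix (Fin n) (Fin n) ℤ :=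
  1 + Matrix.vecMulVec (Pi.single i 1) (cartanInt a i)

theorem reflMatrix_mul_self {n : ℕ} (a : Fin n → ℕ) (i : Fin n) :
    reflMatrix a i * reflMatrix a i = 1 := by
  have h : Matrix.vecMulVec (Pi.single i (1 : ℤ)) (cartanInt a i) *
      Matrix.vecMulVec (Pi.single i (1 : ℤ)) (cartanInt a i) =
      (-2 : ℤ) • Matrix.vecMulVec (Pi.single i (1 : ℤ)) (cartanInt a i) := by
    rw [Matrix.vecMulVec_mul_vecMulVec]
    have hii : cartanInt a i i = -2 := by simp [cartanInt]
    ext k l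
    simp only [dotProduct_single, hii, Matrix.vecMulVec_apply, Matrix.smul_apply, Pi.smul_apply,
      smul_eq_mul]
    ring
  simp only [reflMatrix, mul_add, add_mul, h, one_mul, mul_one]
  module

/-- The reflection `r_i` as an element of `GLₙ(ℤ)`. -/
def rootReflection {n : ℕ} (a : Fin n → ℕ) (i : Fin n) : Matrix.GeneralLinearGroup (Fin n) ℤ :=
  ⟨reflMatrix a i, reflMatrix a i, reflMatrix_mul_self a i, reflMatrix_mul_self a i⟩

/-- The crystallographic linear group `G = ⟨r_0, …, r_{n-1}⟩`. -/
def linGroup {n : ℕ} (a : Fin n → ℕ) : Subgroup (Matrix.GeneralLinearGroup (Fin n) ℤ) :=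
  Subgroup.closure (Set.range (rootReflection a))

/-- Entrywise reduction `GLₙ(ℤ) → GLₙ(ℤ_d)`. -/
def reduce (n d : ℕ) :
    Matrix.GeneralLinearGroup (Fin n) ℤ →* Matrix.GeneralLinearGroup (Fin n) (ZMod d) :=
  Matrix.GeneralLinearGroup.map (Int.castRingHom (ZMod d))

/-- The modular reduction `G^d` of `G`. -/
def modGroup {n : ℕ} (a : Fin n → ℕ) (d : ℕ) :
    Subgroup (Matrix.GeneralLinearGroup (Fin n) (ZMod d)) :=
  (linGroup a).map (reduce n d)

/-- The images in `G^d` of the generators `r_i`. -/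
def modGen {n : ℕ} (a : Fin n → ℕ) (d : ℕ) (i : Fin n) : modGroup a d :=
  ⟨reduce n d (rootReflection a i),
    Subgroup.mem_map_of_mem _ (Subgroup.subset_closure (Set.mem_range_self i))⟩

/-- The names of the four basic systems of the group `[4,3,4,3]`. -/
inductive BasicSystem
  | a | b | c | d
  deriving DecidableEq

/-- The node labels of the diagrams of the four basic systems of `[4,3,4,3]`. -/
def BasicSystem.labels : BasicSystem → Fin 5 → ℕ
  | .a => ![1, 2, 2, 4, 4]
  | .b => ![1, 2, 2, 1, 1]
  | .c => ![2, 1, 1, 2, 2]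
  | .d => ![4, 2, 2, 1, 1]

/-- The type vector of the facets for the modulus `d`. -/
def BasicSystem.typeVector (D : BasicSystem) (d : ℕ) : Fin 3 → ℤ :=
  if D = .d ∧ Even d then ![d, d, 0] else ![d, 0, 0]

/-!
On a string diagram the intersection property follows from
`⟨ρ_k, …, ρ_{l-1}⟩ ∩ ⟨ρ_{k+1}, …, ρ_l⟩ ≤ ⟨ρ_{k+1}, …, ρ_{l-1}⟩` for `k < l`. The first group fixes
the row vector `e_l`, while the second one is the image of a parabolic subgroup of the finite group
`[3, 4, 3]`. Over the integers every nontrivial minimal representative of a coset of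
`⟨ρ_{k+1}, …, ρ_{l-1}⟩` in the second group changes some entry of `e_l` by `1` or `2` in absolute
value. This change does not vanish modulo `d > 2`, so only the elements of the trivial coset can fix
`e_l`. For the same reason `[3, 4, 3]` embeds into `G^d` as the group of the vertex-figure.

The first four reflections preserve a degenerate quadratic form. After an embedding of the root
lattice into `ℤ ⊕ ℤ³ ⊕ ℤ` they become the linear extensions of the symmetries of the tessellation by
unit cubes, so the group of the facet is the quotient of the symmetry group by those symmetries that
reduce to `1`. A symmetry that reduces to `1` is a translation by some `d • c`, since its linear
part is a signed permutation that is trivial modulo `d > 2`. Comparing the first coordinates shows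
that every `c` occurs, except that for the diagram `(d)` and even `d` the sum of the entries of `c`
has to be even. Such translation vectors form the lattice of the toroid of type `q`.

The root systems differ only in the lengths of their roots, by factors that become units modulo an
odd `d`. The resulting diagonal matrices conjugate one set of generators to another.
-/

/-! ### Subgroups generated by subfamilies -/

section Closure

variable {ι Γ : Type*} [Group Γ] {ρ : ι → Γ}

theorem mem_closure_image_of_mem {S : Set ι} {i : ι} (hi : i ∈ S) :
    ρ i ∈ Subgroup.closure (ρ '' S) :=
  Subgroup.subset_closure (Set.mem_image_of_mem _ hi)

theorem closure_image_mono {S T : Set ι} (h : S ⊆ T) :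
    Subgroup.closure (ρ '' S) ≤ Subgroup.closure (ρ '' T) :=
  Subgroup.closure_mono (Set.image_mono h)

theorem map_closure_image {κ Γ' : Type*} [Group Γ'] {σ : κ → Γ'} {φ : Γ' →* Γ} {f : κ → ι}
    (hφ : ∀ i, φ (σ i) = ρ (f i)) (S : Set κ) :
    (Subgroup.closure (σ '' S)).map φ = Subgroup.closure (ρ '' (f '' S)) := by
  rw [MonoidHom.map_closure, Set.image_image, Set.image_image]
  simp only [hφ]

theorem map_mem_closure_image_iff {κ Γ' : Type*} [Group Γ'] {σ : κ → Γ'} {φ : Γ' →* Γ} {f : κ → ι}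
    (hφ : ∀ i, φ (σ i) = ρ (f i)) (hinj : Function.Injective φ) {S : Set κ} {w : Γ'} :
    φ w ∈ Subgroup.closure (ρ '' (f '' S)) ↔ w ∈ Subgroup.closure (σ '' S) := by
  rw [← map_closure_image hφ, Subgroup.mem_map_iff_mem hinj]

theorem closure_image_induction_right {S : Set ι} (hinv : ∀ i, ρ i * ρ i = 1) {p : Γ → Prop}
    (one : p 1) (mul : ∀ x, ∀ i ∈ S, p x → p (x * ρ i)) {x : Γ}
    (hx : x ∈ Subgroup.closure (ρ '' S)) : p x := by
  induction hx using Subgroup.closure_induction_right with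
  | one => exact one
  | mul_right x _ y hy ih =>
    obtain ⟨i, hi, rfl⟩ := hy
    exact mul x i hi ih
  | mul_inv_cancel x _ y hy ih =>
    obtain ⟨i, hi, rfl⟩ := hy
    rw [inv_eq_of_mul_eq_one_right (hinv i)]
    exact mul x i hi ih

theorem closure_image_induction_left {S : Set ι} (hinv : ∀ i, ρ i * ρ i = 1) {p : Γ → Prop}
    (one : p 1) (mul : ∀ x, ∀ i ∈ S, p x → p (ρ i * x)) {x : Γ}
    (hx : x ∈ Subgroup.closure (ρ '' S)) : p x := by
  rw [← inv_inv x]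
  refine closure_image_induction_right hinv (p := fun x => p x⁻¹) (by rwa [inv_one])
    (fun x i hi ih => ?_) (inv_mem hx)
  rw [mul_inv_rev, inv_eq_of_mul_eq_one_right (hinv i)]
  exact mul x⁻¹ i hi ih

theorem commute_of_mem_closure_image {X Y : Set ι} (h : ∀ i ∈ X, ∀ j ∈ Y, Commute (ρ i) (ρ j))
    {x y : Γ} (hx : x ∈ Subgroup.closure (ρ '' X)) (hy : y ∈ Subgroup.closure (ρ '' Y)) :
    Commute x y := by
  have hle : Subgroup.closure (ρ '' X) ≤ Subgroup.centralizer (Subgroup.closure (ρ '' Y)) := by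
    rw [Subgroup.centralizer_closure, Subgroup.closure_le]
    rintro _ ⟨i, hi, rfl⟩
    rw [SetLike.mem_coe, Subgroup.mem_centralizer_iff]
    rintro _ ⟨j, hj, rfl⟩
    exact (h i hi j hj).symm
  exact (Subgroup.mem_centralizer_iff.1 (hle hx) y hy).symm

theorem exists_mul_of_mem_closure_image_union {X Y : Set ι}
    (h : ∀ i ∈ X, ∀ j ∈ Y, Commute (ρ i) (ρ j)) {g : Γ}
    (hg : g ∈ Subgroup.closure (ρ '' (X ∪ Y))) :
    ∃ x ∈ Subgroup.closure (ρ '' X), ∃ y ∈ Subgroup.closure (ρ '' Y), g = x * y := by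
  have hcomm : ∀ (x : Subgroup.closure (ρ '' X)) (y : Subgroup.closure (ρ '' Y)),
      Commute (x : Γ) y := fun x y => commute_of_mem_closure_image h x.2 y.2
  rw [Set.image_union, Subgroup.closure_union, ← Subgroup.range_subtype (Subgroup.closure (ρ '' X)),
    ← Subgroup.range_subtype (Subgroup.closure (ρ '' Y)),
    ← MonoidHom.noncommCoprod_range _ _ hcomm] at hg
  obtain ⟨⟨x, y⟩, rfl⟩ := hg
  exact ⟨x, x.2, y, y.2, rfl⟩

theorem mem_closure_singleton_of_mul_self {a x : Γ} (ha : a * a = 1)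
    (hx : x ∈ Subgroup.closure {a}) : x = 1 ∨ x = a := by
  obtain ⟨m, rfl⟩ := Subgroup.mem_closure_singleton.1 hx
  obtain ⟨k, rfl | rfl⟩ := m.even_or_odd'
  · exact .inl (by rw [zpow_mul, zpow_two, ha, one_zpow])
  · exact .inr (by rw [zpow_add_one, zpow_mul, zpow_two, ha, one_zpow, one_mul])

end Closure

/-! ### Coset geometries -/

namespace CosetFace

variable {n : ℕ} {Γ : Type*} [Group Γ] {ρ : Fin n → Γ}

/-- The face with index `j` (hence of rank `j - 1`) that contains the group element `g`. -/
def of (ρ : Fin n → Γ) (g : Γ) (j : Fin (n + 2)) : CosetFace ρ :=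
  ⟨j, (g : Γ ⧸ faceSubgroup ρ j)⟩

/-- A face, being a coset, has the group elements of this coset as members. -/
instance : Membership Γ (CosetFace ρ) where
  mem F g := (g : Γ ⧸ faceSubgroup ρ F.idx) = F.coset

@[simp] theorem of_idx (g : Γ) (j : Fin (n + 2)) : (of ρ g j).idx = j := rfl

theorem mem_of_iff {g h : Γ} {j : Fin (n + 2)} : h ∈ of ρ g j ↔ g⁻¹ * h ∈ faceSubgroup ρ j := by
  rw [← QuotientGroup.eq]
  exact eq_comm

theorem mem_iff_of_eq {F : CosetFace ρ} {g : Γ} : g ∈ F ↔ of ρ g F.idx = F := by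
  obtain ⟨j, x⟩ := F
  change (g : Γ ⧸ faceSubgroup ρ j) = x ↔ (⟨j, g⟩ : CosetFace ρ) = ⟨j, x⟩
  simp only [CosetFace.mk.injEq, heq_eq_eq, true_and]

@[simp] theorem mem_of (g : Γ) (j : Fin (n + 2)) : g ∈ of ρ g j := rfl

theorem exists_mem (F : CosetFace ρ) : ∃ g, g ∈ F :=
  QuotientGroup.mk_surjective F.coset

theorem eq_of_mem {F G : CosetFace ρ} {g : Γ} (hF : g ∈ F) (hG : g ∈ G) (hi : F.idx = G.idx) :
    F = G := by
  rw [← mem_iff_of_eq.1 hF, ← mem_iff_of_eq.1 hG, hi]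

theorem of_eq_of_iff {g h : Γ} {j : Fin (n + 2)} : of ρ g j = of ρ h j ↔ h ∈ of ρ g j :=
  ⟨fun H => H ▸ mem_of h j, fun H => eq_of_mem H (mem_of h j) rfl⟩

theorem mul_mem_iff {F : CosetFace ρ} {g x : Γ} (hx : x ∈ faceSubgroup ρ F.idx) :
    g * x ∈ F ↔ g ∈ F :=
  Eq.congr_left (QuotientGroup.mk_mul_of_mem g hx)

theorem inv_mul_mem_faceSubgroup {F : CosetFace ρ} {g h : Γ} (hg : g ∈ F) (hh : h ∈ F) :
    g⁻¹ * h ∈ faceSubgroup ρ F.idx :=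
  QuotientGroup.eq.1 (hg.trans hh.symm)

theorem gen_mem_faceSubgroup {i : Fin n} {j : Fin (n + 2)} (h : (i : ℕ) + 1 ≠ j) :
    ρ i ∈ faceSubgroup ρ j :=
  mem_closure_image_of_mem h

theorem closure_image_le_faceSubgroup {S : Set (Fin n)} {j : Fin (n + 2)}
    (h : ∀ i ∈ S, (i : ℕ) + 1 ≠ j) : Subgroup.closure (ρ '' S) ≤ faceSubgroup ρ j :=
  closure_image_mono h

theorem mul_gen_mem_iff {F : CosetFace ρ} {g : Γ} {i : Fin n} (h : (i : ℕ) + 1 ≠ F.idx) :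
    g * ρ i ∈ F ↔ g ∈ F :=
  mul_mem_iff (gen_mem_faceSubgroup h)

theorem of_mul_gen {g : Γ} {i : Fin n} {j : Fin (n + 2)} (h : (i : ℕ) + 1 ≠ j) :
    of ρ (g * ρ i) j = of ρ g j :=
  (of_eq_of_iff.2 ((mul_gen_mem_iff h).2 (mem_of g j))).symm

theorem le_iff {F G : CosetFace ρ} : F ≤ G ↔ F.idx ≤ G.idx ∧ ∃ g, g ∈ F ∧ g ∈ G := Iff.rfl

theorem le_of_mem {F G : CosetFace ρ} {g : Γ} (hF : g ∈ F) (hG : g ∈ G) (h : F.idx ≤ G.idx) :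
    F ≤ G :=
  ⟨h, g, hF, hG⟩

theorem of_le_of {g : Γ} {j k : Fin (n + 2)} (h : j ≤ k) : of ρ g j ≤ of ρ g k :=
  le_of_mem (mem_of g j) (mem_of g k) h

theorem eq_of_le_of_idx_eq {F G : CosetFace ρ} (h : F ≤ G) (hi : F.idx = G.idx) : F = G :=
  let ⟨_, _, hF, hG⟩ := h
  eq_of_mem hF hG hi

instance : Std.Refl (α := CosetFace ρ) (· ≤ ·) where
  refl F := let ⟨_, hg⟩ := F.exists_mem; le_of_mem hg hg le_rfl

protected theorem le_antisymm {F G : CosetFace ρ} (h : F ≤ G) (h' : G ≤ F) : F = G :=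
  eq_of_le_of_idx_eq h (le_antisymm h.1 h'.1)

theorem idx_lt {F G : CosetFace ρ} (h : F ≤ G) (hne : F ≠ G) : F.idx < G.idx :=
  lt_of_le_of_ne h.1 fun H => hne (eq_of_le_of_idx_eq h H)

theorem idx_injOn_of_isChain {c : Set (CosetFace ρ)} (hc : IsChain (· ≤ ·) c) :
    Set.InjOn CosetFace.idx c := by
  intro F hF G hG hi
  rcases hc.total hF hG with h | h
  · exact eq_of_le_of_idx_eq h hi
  · exact (eq_of_le_of_idx_eq h hi.symm).symm

theorem le_of_isChain {c : Set (CosetFace ρ)} (hc : IsChain (· ≤ ·) c) {F G : CosetFace ρ}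
    (hF : F ∈ c) (hG : G ∈ c) (hi : F.idx ≤ G.idx) : F ≤ G := by
  rcases hc.total hF hG with h | h
  · exact h
  · exact eq_of_le_of_idx_eq h (le_antisymm h.1 hi) ▸ refl _

theorem faceSubgroup_eq_top (hgen : Subgroup.closure (Set.range ρ) = ⊤) {j : Fin (n + 2)}
    (hj : ∀ i : Fin n, (i : ℕ) + 1 ≠ j) : faceSubgroup ρ j = ⊤ := by
  have huniv : {i : Fin n | (i : ℕ) + 1 ≠ j} = Set.univ := Set.eq_univ_of_forall hj
  rw [faceSubgroup, huniv, Set.image_univ, hgen]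

section LeftMul

/-- Left multiplication by `g`, as an automorphism of the coset geometry. -/
def leftMul (g : Γ) : CosetFace ρ ≃o CosetFace ρ where
  toFun F := ⟨F.idx, g • F.coset⟩
  invFun F := ⟨F.idx, g⁻¹ • F.coset⟩
  left_inv F := by simp
  right_inv F := by simp
  map_rel_iff' := by
    have smul_le_smul (g : Γ) (F G : CosetFace ρ) :
        F ≤ G → (⟨F.idx, g • F.coset⟩ : CosetFace ρ) ≤ ⟨G.idx, g • G.coset⟩ :=
      fun ⟨hi, x, hF, hG⟩ => ⟨hi, g * x, congrArg (g • ·) hF, congrArg (g • ·) hG⟩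
    intro F G
    exact ⟨fun h => by simpa using smul_le_smul g⁻¹ _ _ h, smul_le_smul g F G⟩

@[simp] theorem leftMul_of (g x : Γ) (j : Fin (n + 2)) :
    leftMul g (of ρ x j) = of ρ (g * x) j := rfl

@[ext] theorem orderIso_ext {f f' : CosetFace ρ ≃o CosetFace ρ}
    (h : ∀ g j, f (of ρ g j) = f' (of ρ g j)) : f = f' := by
  refine RelIso.ext fun F => ?_
  obtain ⟨g, hg⟩ := F.exists_mem
  rw [← mem_iff_of_eq.1 hg, h]

theorem idx_orderIso (f : CosetFace ρ ≃o CosetFace ρ) (F : CosetFace ρ) : (f F).idx = F.idx := by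
  obtain ⟨g, hg⟩ := F.exists_mem
  have hmono : StrictMono fun j => (f (of ρ g j)).idx := fun j k hjk =>
    idx_lt (f.map_rel_iff.2 (of_le_of hjk.le)) fun h =>
      hjk.ne (congrArg CosetFace.idx (f.injective h))
  rw [← mem_iff_of_eq.1 hg]
  exact le_antisymm hmono.apply_le hmono.le_apply

/-- The action of the group on its coset geometry by left multiplication. -/
def leftMulHom (ρ : Fin n → Γ) : Γ →* (CosetFace ρ ≃o CosetFace ρ) where
  toFun := leftMul
  map_one' := orderIso_ext fun x j => by rw [leftMul_of, one_mul, RelIso.one_apply]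
  map_mul' g h := orderIso_ext fun x j => by simp only [RelIso.mul_apply, leftMul_of, mul_assoc]

@[simp] theorem leftMulHom_apply (g : Γ) : leftMulHom ρ g = leftMul g := rfl

theorem nonempty_lower_iso (F : CosetFace ρ) :
    Nonempty ({H // H ≤ F} ≃o {H // H ≤ of ρ 1 F.idx}) := by
  obtain ⟨g, hg⟩ := F.exists_mem
  have hF : leftMul g⁻¹ F = of ρ 1 F.idx := by
    rw [← mem_iff_of_eq.1 hg, leftMul_of, inv_mul_cancel, of_idx]
  refine ⟨(leftMul g⁻¹).toEquiv.subtypeEquiv fun H => ?_, (leftMul g⁻¹).map_rel_iff⟩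
  rw [← hF]
  exact ((leftMul g⁻¹).map_rel_iff (a := H)).symm

theorem nonempty_upper_iso (F : CosetFace ρ) :
    Nonempty ({H // F ≤ H} ≃o {H // of ρ 1 F.idx ≤ H}) := by
  obtain ⟨g, hg⟩ := F.exists_mem
  have hF : leftMul g⁻¹ F = of ρ 1 F.idx := by
    rw [← mem_iff_of_eq.1 hg, leftMul_of, inv_mul_cancel, of_idx]
  refine ⟨(leftMul g⁻¹).toEquiv.subtypeEquiv fun H => ?_, (leftMul g⁻¹).map_rel_iff⟩
  rw [← hF]
  exact ((leftMul g⁻¹).map_rel_iff (b := H)).symm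

end LeftMul

section Commute

variable (hc : ∀ i j : Fin n, (i : ℕ) + 2 ≤ j → Commute (ρ i) (ρ j))
include hc

theorem exists_mul_of_mem_faceSubgroup {j : Fin (n + 2)} {a : Γ} (ha : a ∈ faceSubgroup ρ j) :
    ∃ x ∈ Subgroup.closure (ρ '' {i | (i : ℕ) + 1 < j}),
      ∃ y ∈ Subgroup.closure (ρ '' {i | (j : ℕ) < i + 1}), a = y * x := by
  have hsplit : {i : Fin n | (i : ℕ) + 1 ≠ j} =
      {i : Fin n | (i : ℕ) + 1 < j} ∪ {i : Fin n | (j : ℕ) < i + 1} :=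
    Set.ext fun i => ne_iff_lt_or_gt
  have hcomm : ∀ i ∈ {i : Fin n | (i : ℕ) + 1 < j}, ∀ k ∈ {i : Fin n | (j : ℕ) < i + 1},
      Commute (ρ i) (ρ k) := by
    intro i (hi : (i : ℕ) + 1 < j) k (hk : (j : ℕ) < k + 1)
    exact hc i k (by omega)
  rw [faceSubgroup, hsplit] at ha
  obtain ⟨x, hx, y, hy, rfl⟩ := exists_mul_of_mem_closure_image_union hcomm ha
  exact ⟨x, hx, y, hy, (commute_of_mem_closure_image hcomm hx hy).eq⟩

theorem exists_mem_of_le {F H : CosetFace ρ} (h : F ≤ H) {g : Γ} (hg : g ∈ F) :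
    ∃ g' ∈ H, ∀ E : CosetFace ρ, E.idx ≤ F.idx → g ∈ E → g' ∈ E := by
  obtain ⟨hi, x, hxF, hxH⟩ := h
  obtain ⟨a, ha, b, hb, hab⟩ := exists_mul_of_mem_faceSubgroup hc (inv_mul_mem_faceSubgroup hg hxF)
  have hx : g * b = x * a⁻¹ := by
    rw [eq_mul_inv_iff_mul_eq, mul_assoc, ← hab, mul_inv_cancel_left]
  have ha' : a ∈ faceSubgroup ρ H.idx :=
    closure_image_le_faceSubgroup (fun k hk => (lt_of_lt_of_le hk (Fin.le_def.1 hi)).ne) ha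
  have hb' (E : CosetFace ρ) (hE : E.idx ≤ F.idx) : b ∈ faceSubgroup ρ E.idx :=
    closure_image_le_faceSubgroup (fun k hk => (lt_of_le_of_lt (Fin.le_def.1 hE) hk).ne') hb
  refine ⟨g * b, ?_, fun E hE hgE => (mul_mem_iff (hb' E hE)).2 hgE⟩
  rw [hx, mul_mem_iff (inv_mem ha')]
  exact hxH

theorem exists_mem_of_le_of_le {F G H : CosetFace ρ} (h : F ≤ G) (h' : G ≤ H) :
    ∃ g, g ∈ F ∧ g ∈ G ∧ g ∈ H := by
  obtain ⟨hi, x, hxF, hxG⟩ := h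
  obtain ⟨g, hgH, hg⟩ := exists_mem_of_le hc h' hxG
  exact ⟨g, hg F hi hxF, hg G le_rfl hxG, hgH⟩

protected theorem le_trans {F G H : CosetFace ρ} (h : F ≤ G) (h' : G ≤ H) : F ≤ H := by
  obtain ⟨g, hF, -, hH⟩ := exists_mem_of_le_of_le hc h h'
  exact le_of_mem hF hH (h.1.trans h'.1)

theorem exists_mem_of_isChain {c : Set (CosetFace ρ)} (h : IsChain (· ≤ ·) c) :
    ∃ g, ∀ F ∈ c, g ∈ F := by
  classical
  lift c to Finset (CosetFace ρ) using Set.Finite.of_finite_image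
    (Set.toFinite _) (idx_injOn_of_isChain h)
  revert h
  refine Finset.induction_on_max_value CosetFace.idx c (by simp) fun F s _ hmax ih h => ?_
  · rw [Finset.coe_insert] at h
    obtain ⟨g, hg⟩ := ih (h.mono (Set.subset_insert _ _))
    rcases s.eq_empty_or_nonempty with rfl | hs
    · simpa using F.exists_mem
    · obtain ⟨E, hE, hEmax⟩ := s.exists_max_image CosetFace.idx hs
      have hEF : E ≤ F := le_of_isChain h (.inr hE) (.inl rfl) (hmax E hE)
      obtain ⟨g', hg', hsub⟩ := exists_mem_of_le hc hEF (hg E hE)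
      refine ⟨g', fun G hG => ?_⟩
      rcases Finset.mem_insert.1 hG with rfl | hG
      · exact hg'
      · exact hsub G (hEmax G hG) (hg G hG)

theorem exists_flag_eq_range (Φ : Flag (CosetFace ρ)) :
    ∃ g, (Φ : Set (CosetFace ρ)) = Set.range (of ρ g) := by
  obtain ⟨g, hg⟩ := exists_mem_of_isChain hc Φ.chain_le
  refine ⟨g, Φ.max_chain' ?_ fun F hF => ⟨F.idx, mem_iff_of_eq.1 (hg F hF)⟩⟩
  rintro _ ⟨i, rfl⟩ _ ⟨j, rfl⟩ -
  exact (le_total i j).imp of_le_of of_le_of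

end Commute

section Flags

variable {F G : CosetFace ρ}

theorem isChain_mem (g : Γ) : IsChain (· ≤ ·) {H : {H : CosetFace ρ // F ≤ H ∧ H ≤ G} | g ∈ H.1} :=
  fun A hA B hB _ => (le_total A.1.idx B.1.idx).imp (le_of_mem hA hB) (le_of_mem hB hA)

/-- The flag of the section `G/F` whose faces contain a given common element of `F` and `G`. -/
def sectionFlag {g : Γ} (hF : g ∈ F) (hG : g ∈ G) : Flag {H : CosetFace ρ // F ≤ H ∧ H ≤ G} where
  carrier := {H | g ∈ H.1}
  Chain' := isChain_mem g
  max_chain' s hs hsub := by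
    refine Set.Subset.antisymm hsub fun H hH => ?_
    let K : {H : CosetFace ρ // F ≤ H ∧ H ≤ G} :=
      ⟨of ρ g H.1.idx, le_of_mem hF (mem_of g _) H.2.1.1, le_of_mem (mem_of g _) hG H.2.2.1⟩
    have hK : K ∈ s := hsub (mem_of g _)
    have hHK : H.1 = K.1 := by
      by_cases he : H = K
      · rw [he]
      · exact (hs hH hK he).elim (eq_of_le_of_idx_eq · rfl) (eq_of_le_of_idx_eq · rfl |>.symm)
    change g ∈ H.1
    rw [hHK]
    exact mem_of g _

@[simp] theorem mem_sectionFlag {g : Γ} (hF : g ∈ F) (hG : g ∈ G)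
    (H : {H : CosetFace ρ // F ≤ H ∧ H ≤ G}) : H ∈ sectionFlag hF hG ↔ g ∈ H.1 := Iff.rfl

theorem exists_eq_sectionFlag (hc : ∀ i j : Fin n, (i : ℕ) + 2 ≤ j → Commute (ρ i) (ρ j))
    (hFG : F ≤ G) (Φ : Flag {H : CosetFace ρ // F ≤ H ∧ H ≤ G}) :
    ∃ (g : Γ) (hF : g ∈ F) (hG : g ∈ G), Φ = sectionFlag hF hG := by
  have hchain : IsChain (· ≤ ·) (insert F (insert G
      (Subtype.val '' (Φ : Set {H : CosetFace ρ // F ≤ H ∧ H ≤ G})))) := by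
    refine ((Φ.chain_le.image_of_map_rel _ _ Subtype.val fun _ _ h => h).insert ?_).insert ?_
    · rintro _ ⟨A, -, rfl⟩ -
      exact .inr A.2.2
    · rintro _ (rfl | ⟨A, -, rfl⟩) -
      · exact .inl hFG
      · exact .inl A.2.1
  obtain ⟨g, hg⟩ := exists_mem_of_isChain hc hchain
  refine ⟨g, hg F (by simp), hg G (by simp), Flag.ext (Φ.max_chain' (isChain_mem g) ?_)⟩
  exact fun A hA => hg A.1 (.inr (.inr ⟨A, hA, rfl⟩))

theorem sectionFlag_sdiff {g h : Γ} (hgF : g ∈ F) (hgG : g ∈ G) (hhF : h ∈ F) (hhG : h ∈ G)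
    {k : Fin (n + 2)} (hFk : F.idx ≤ k) (hkG : k ≤ G.idx)
    (hsame : ∀ H : CosetFace ρ, H.idx ≠ k → (h ∈ H ↔ g ∈ H)) (hdiff : h ∉ of ρ g k) :
    ((sectionFlag hgF hgG : Set {H : CosetFace ρ // F ≤ H ∧ H ≤ G}) \ sectionFlag hhF hhG) =
      {⟨of ρ g k, le_of_mem hgF (mem_of g k) hFk, le_of_mem (mem_of g k) hgG hkG⟩} := by
  ext H
  simp only [Set.mem_sdiff, SetLike.mem_coe, mem_sectionFlag, Set.mem_singleton_iff,
    Subtype.ext_iff]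
  constructor
  · rintro ⟨hgH, hhH⟩
    refine eq_of_mem hgH (mem_of g k) ?_
    by_contra hk
    exact hhH ((hsame _ hk).2 hgH)
  · intro hH
    exact hH ▸ ⟨mem_of g k, hdiff⟩

end Flags

end CosetFace

/-! ### The polytope of a string C-group -/

namespace IsStringCGroup

open CosetFace

variable {n : ℕ} {Γ : Type*} [Group Γ] {ρ : Fin n → Γ} (hρ : IsStringCGroup ρ)
include hρ

theorem mul_self (i : Fin n) : ρ i * ρ i = 1 := by
  rw [← pow_two, ← hρ.involution i, pow_orderOf_eq_one]

theorem ne_one (i : Fin n) : ρ i ≠ 1 := by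
  rw [Ne, ← orderOf_eq_one_iff, hρ.involution i]
  decide

theorem gen_notMem_closure_image {i : Fin n} {S : Set (Fin n)} (hi : i ∉ S) :
    ρ i ∉ Subgroup.closure (ρ '' S) := by
  intro hmem
  have hinf : ρ i ∈ Subgroup.closure (ρ '' {i}) ⊓ Subgroup.closure (ρ '' S) :=
    ⟨mem_closure_image_of_mem rfl, hmem⟩
  rw [hρ.intersection, Set.singleton_inter_eq_empty.2 hi, Set.image_empty, Subgroup.closure_empty,
    Subgroup.mem_bot] at hinf
  exact hρ.ne_one i hinf

theorem mul_gen_notMem_of {g : Γ} {i : Fin n} {k : Fin (n + 2)} (hk : (i : ℕ) + 1 = k) :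
    g * ρ i ∉ of ρ g k := by
  rw [mem_of_iff, inv_mul_cancel_left]
  exact hρ.gen_notMem_closure_image (not_not.2 hk)

theorem mem_of_idx_eq_zero {F : CosetFace ρ} (h : F.idx = 0) (g : Γ) : g ∈ F := by
  obtain ⟨x, hx⟩ := F.exists_mem
  rw [← mem_iff_of_eq.1 hx, h, mem_of_iff, faceSubgroup_eq_top hρ.generate (by simp)]
  trivial

theorem mem_of_idx_eq_last {F : CosetFace ρ} (h : F.idx = Fin.last _) (g : Γ) : g ∈ F := by
  obtain ⟨x, hx⟩ := F.exists_mem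
  rw [← mem_iff_of_eq.1 hx, h, mem_of_iff,
    faceSubgroup_eq_top hρ.generate fun i => by rw [Fin.val_last]; omega]
  trivial

theorem eq_or_eq_of_le_of_le {g : Γ} {i : Fin n} {j k l : Fin (n + 2)} (hj : (j : ℕ) = i)
    (hk : (i : ℕ) + 1 = k) (hl : (l : ℕ) = i + 2) {H : CosetFace ρ} (hjH : of ρ g j ≤ H)
    (hHl : H ≤ of ρ g l) (hH : H.idx = k) : H = of ρ g k ∨ H = of ρ (g * ρ i) k := by
  obtain ⟨y, hyj, hyH, hyl⟩ := exists_mem_of_le_of_le hρ.commute hjH hHl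
  have hy : g⁻¹ * y ∈ faceSubgroup ρ j ⊓ faceSubgroup ρ l := ⟨mem_of_iff.1 hyj, mem_of_iff.1 hyl⟩
  have hsplit : {a : Fin n | (a : ℕ) + 1 ≠ j} ∩ {a : Fin n | (a : ℕ) + 1 ≠ l} =
      {i} ∪ {a : Fin n | (a : ℕ) + 2 ≤ i ∨ (i : ℕ) + 2 ≤ a} := by
    ext a
    simp only [Set.mem_inter_iff, Set.mem_ofPred_eq, Set.mem_union, Set.mem_singleton_iff,
      Fin.ext_iff]
    omega
  rw [faceSubgroup, faceSubgroup, hρ.intersection, hsplit] at hy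
  obtain ⟨x, hx, z, hz, hxz⟩ := exists_mul_of_mem_closure_image_union (by
    rintro _ rfl a (ha | ha)
    · exact (hρ.commute a _ ha).symm
    · exact hρ.commute _ a ha) hy
  have hz : z ∈ faceSubgroup ρ H.idx := by
    refine closure_image_le_faceSubgroup (fun a ha => ?_) hz
    rw [Set.mem_ofPred_eq] at ha
    omega
  have hgx : g * x ∈ H := by
    rw [← mul_mem_iff hz, mul_assoc, ← hxz, mul_inv_cancel_left]
    exact hyH
  rw [Set.image_singleton] at hx
  rcases mem_closure_singleton_of_mul_self (hρ.mul_self i) hx with rfl | rfl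
  · exact .inl (eq_of_mem hgx (by simp) hH)
  · exact .inr (eq_of_mem hgx (by simp) hH)

theorem reachable_sectionFlag_mul_gen {F G : CosetFace ρ} {g : Γ} {i : Fin n} (hF : g ∈ F)
    (hG : g ∈ G) (hF' : g * ρ i ∈ F) (hG' : g * ρ i ∈ G) :
    (flagGraph _).Reachable (sectionFlag hF hG) (sectionFlag hF' hG') := by
  let k : Fin (n + 2) := ⟨i + 1, by omega⟩
  have hsame (H : CosetFace ρ) (hH : H.idx ≠ k) : g * ρ i ∈ H ↔ g ∈ H :=
    mul_gen_mem_iff fun h => hH (Fin.ext h.symm)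
  by_cases hk : F.idx ≤ k ∧ k ≤ G.idx
  · have hdiff : g * ρ i ∉ of ρ g k := hρ.mul_gen_notMem_of rfl
    refine SimpleGraph.Adj.reachable ⟨?_, ?_⟩
    · rw [sectionFlag_sdiff hF hG hF' hG' hk.1 hk.2 hsame hdiff, Set.ncard_singleton]
    · rw [sectionFlag_sdiff hF' hG' hF hG hk.1 hk.2 (fun H hH => (hsame H hH).symm)
        fun h => hdiff (of_eq_of_iff.1 (of_eq_of_iff.2 h).symm), Set.ncard_singleton]
  · have heq : sectionFlag hF hG = sectionFlag hF' hG' := by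
      refine Flag.ext (Set.ext fun H => (hsame H.1 ?_).symm)
      rintro h
      exact hk (h ▸ ⟨H.2.1.1, H.2.2.1⟩)
    rw [heq]

theorem reachable_sectionFlag {F G : CosetFace ρ} {g h : Γ} (hgF : g ∈ F) (hgG : g ∈ G)
    (hhF : h ∈ F) (hhG : h ∈ G) :
    (flagGraph _).Reachable (sectionFlag hgF hgG) (sectionFlag hhF hhG) := by
  have hx : g⁻¹ * h ∈ faceSubgroup ρ F.idx ⊓ faceSubgroup ρ G.idx :=
    ⟨inv_mul_mem_faceSubgroup hgF hhF, inv_mul_mem_faceSubgroup hgG hhG⟩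
  rw [faceSubgroup, faceSubgroup, hρ.intersection] at hx
  suffices ∀ (hF' : g * (g⁻¹ * h) ∈ F) (hG' : g * (g⁻¹ * h) ∈ G),
      (flagGraph _).Reachable (sectionFlag hgF hgG) (sectionFlag hF' hG') by
    simpa only [mul_inv_cancel_left, hhF, hhG, forall_true_left] using this
  refine closure_image_induction_right (p := fun x => ∀ (hF' : g * x ∈ F) (hG' : g * x ∈ G),
    (flagGraph _).Reachable (sectionFlag hgF hgG) (sectionFlag hF' hG')) hρ.mul_self ?_ ?_ hx
  · simp only [mul_one]
    exact fun _ _ => .rfl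
  · rintro x i ⟨hiF, hiG⟩ ih hF' hG'
    simp only [← mul_assoc] at hF' hG' ⊢
    exact (ih ((mul_gen_mem_iff hiF).1 hF') ((mul_gen_mem_iff hiG).1 hG')).trans
      (hρ.reachable_sectionFlag_mul_gen _ _ _ _)

theorem connected_flagGraph_section {F G : CosetFace ρ} (hFG : F ≤ G) :
    (flagGraph {H : CosetFace ρ // F ≤ H ∧ H ≤ G}).Connected where
  preconnected Φ Ψ := by
    obtain ⟨g, hgF, hgG, rfl⟩ := exists_eq_sectionFlag hρ.commute hFG Φ
    obtain ⟨h, hhF, hhG, rfl⟩ := exists_eq_sectionFlag hρ.commute hFG Ψ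
    exact hρ.reachable_sectionFlag hgF hgG hhF hhG
  nonempty :=
    let ⟨_, _, hF, hG⟩ := hFG
    ⟨sectionFlag hF hG⟩

theorem ncard_between {F G : CosetFace ρ} (hFG : F ≤ G) (hrk : G.rk = F.rk + 2) :
    {H : CosetFace ρ | F ≤ H ∧ H ≤ G ∧ H.rk = F.rk + 1}.ncard = 2 := by
  obtain ⟨-, g, hF, hG⟩ := hFG
  simp only [CosetFace.rk] at hrk
  have hi : (F.idx : ℕ) < n := by omega
  let i : Fin n := ⟨F.idx, hi⟩
  let k : Fin (n + 2) := ⟨F.idx + 1, by omega⟩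
  have hle (h : Γ) (hhF : h ∈ F) (hhG : h ∈ G) :
      F ≤ of ρ h k ∧ of ρ h k ≤ G ∧ (of ρ h k).rk = F.rk + 1 := by
    refine ⟨le_of_mem hhF (mem_of h k) ?_, le_of_mem (mem_of h k) hhG ?_, ?_⟩
    · simp [Fin.le_def, k]
    · rw [Fin.le_def]
      change (F.idx : ℕ) + 1 ≤ _
      omega
    · simp only [CosetFace.rk, of_idx, k]
      omega
  have hset : {H : CosetFace ρ | F ≤ H ∧ H ≤ G ∧ H.rk = F.rk + 1} =
      {of ρ g k, of ρ (g * ρ i) k} := by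
    ext H
    constructor
    · rintro ⟨hFH, hHG, hH⟩
      simp only [CosetFace.rk] at hH
      rw [← mem_iff_of_eq.1 hF] at hFH
      rw [← mem_iff_of_eq.1 hG] at hHG
      exact hρ.eq_or_eq_of_le_of_le (i := i) (k := k) rfl rfl (by change _ = (F.idx : ℕ) + 2; omega)
        hFH hHG (Fin.ext (by change _ = (F.idx : ℕ) + 1; omega))
    · rintro (rfl | rfl)
      · exact hle g hF hG
      · exact hle _ ((mul_gen_mem_iff (Nat.succ_ne_self _)).2 hF)
          ((mul_gen_mem_iff (by change (F.idx : ℕ) + 1 ≠ _; omega)).2 hG)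
  rw [hset, Set.ncard_pair]
  exact fun h => hρ.mul_gen_notMem_of rfl (of_eq_of_iff.1 h)

theorem isRegularPolytope : IsRegularPolytope n (CosetFace ρ) CosetFace.rk where
  partialOrder :=
    { refl := refl
      trans := fun _ _ _ => CosetFace.le_trans hρ.commute
      antisymm := fun _ _ => CosetFace.le_antisymm }
  rk_strictMono F G h hne := by
    have : (F.idx : ℕ) < G.idx := idx_lt h hne
    simp only [CosetFace.rk]
    omega
  rk_range := by
    refine Set.Subset.antisymm (Set.range_subset_iff.2 fun F => ?_) fun z ⟨hz, hz'⟩ => ?_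
    · simp only [CosetFace.rk, Set.mem_Icc]
      omega
    · refine ⟨of ρ 1 ⟨(z + 1).toNat, by omega⟩, ?_⟩
      simp only [CosetFace.rk, of_idx]
      omega
  least := by
    refine ⟨of ρ 1 0, by simp [CosetFace.rk], fun G => ?_⟩
    obtain ⟨g, hg⟩ := G.exists_mem
    exact le_of_mem (hρ.mem_of_idx_eq_zero rfl g) hg (Fin.zero_le _)
  greatest := by
    refine ⟨of ρ 1 (Fin.last _), by simp [CosetFace.rk], fun G => ?_⟩
    obtain ⟨g, hg⟩ := G.exists_mem
    exact le_of_mem hg (hρ.mem_of_idx_eq_last rfl g) (Fin.le_last _)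
  flag_card Φ := by
    obtain ⟨g, hg⟩ := exists_flag_eq_range hρ.commute Φ
    rw [hg, ← Set.image_univ, Set.ncard_image_of_injective _ fun i j h => congrArg CosetFace.idx h,
      Set.ncard_univ, Nat.card_fin]
  diamond _ _ := hρ.ncard_between
  connected _ _ := hρ.connected_flagGraph_section
  flag_transitive Φ Ψ := by
    obtain ⟨g, hg⟩ := exists_flag_eq_range hρ.commute Φ
    obtain ⟨h, hh⟩ := exists_flag_eq_range hρ.commute Ψ
    refine ⟨leftMul (h * g⁻¹), ?_⟩
    rw [hg, hh, ← Set.range_comp]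
    refine congrArg Set.range (funext fun j => ?_)
    rw [Function.comp_apply, leftMul_of, inv_mul_cancel_right]

theorem eq_one_of_forall_mem_faceSubgroup {g : Γ} (hg : ∀ j, g ∈ faceSubgroup ρ j) : g = 1 := by
  have hmem (k : ℕ) (hk : k ≤ n) : g ∈ Subgroup.closure (ρ '' {i | k ≤ (i : ℕ)}) := by
    induction k with
    | zero => simpa [faceSubgroup] using hg 0
    | succ k ih =>
      have hinf : g ∈ _ ⊓ faceSubgroup ρ ⟨k + 1, by omega⟩ := ⟨ih (by omega), hg _⟩
      rw [faceSubgroup, hρ.intersection] at hinf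
      refine closure_image_mono ?_ hinf
      rintro i ⟨(hi : k ≤ i), (hne : (i : ℕ) + 1 ≠ k + 1)⟩
      change k + 1 ≤ (i : ℕ)
      omega
  have hempty : {i : Fin n | n ≤ (i : ℕ)} = ∅ := Set.eq_empty_of_forall_notMem fun i => i.2.not_ge
  simpa [hempty] using hmem n le_rfl

theorem leftMulHom_injective : Function.Injective (leftMulHom ρ) := by
  refine (injective_iff_map_eq_one _).2 fun g hg => ?_
  refine hρ.eq_one_of_forall_mem_faceSubgroup fun j => ?_
  have hj : of ρ (g * 1) j = of ρ 1 j := DFunLike.congr_fun hg (of ρ 1 j)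
  simpa [mem_of_iff] using of_eq_of_iff.1 hj.symm

theorem orderIso_of_mul_gen {f : CosetFace ρ ≃o CosetFace ρ} {g h : Γ}
    (hf : ∀ j, f (of ρ g j) = of ρ h j) (i : Fin n) (j : Fin (n + 2)) :
    f (of ρ (g * ρ i) j) = of ρ (h * ρ i) j := by
  by_cases hj : (i : ℕ) + 1 = j
  · let j₀ : Fin (n + 2) := ⟨i, by omega⟩
    let j₂ : Fin (n + 2) := ⟨i + 2, by omega⟩
    have hlow : of ρ h j₀ ≤ f (of ρ (g * ρ i) j) := by
      rw [← hf, f.map_rel_iff, ← of_mul_gen (i := i) (by simp [j₀])]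
      exact of_le_of (by simp [Fin.le_def, j₀, ← hj])
    have hupp : f (of ρ (g * ρ i) j) ≤ of ρ h j₂ := by
      rw [← hf, f.map_rel_iff, ← of_mul_gen (g := g) (i := i) (by simp [j₂])]
      exact of_le_of (by simp [Fin.le_def, j₂, ← hj])
    refine (hρ.eq_or_eq_of_le_of_le rfl hj rfl hlow hupp (idx_orderIso f _)).resolve_left ?_
    rw [← hf]
    exact fun H => hρ.mul_gen_notMem_of hj (of_eq_of_iff.1 (f.injective H).symm)
  · rw [of_mul_gen hj, of_mul_gen hj, hf]

theorem leftMulHom_surjective : Function.Surjective (leftMulHom ρ) := by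
  intro f
  have hchain : IsChain (· ≤ ·) (Set.range fun j => f (of ρ 1 j)) := by
    rintro _ ⟨i, rfl⟩ _ ⟨j, rfl⟩ -
    exact (le_total i j).imp (f.map_rel_iff.2 <| of_le_of ·) (f.map_rel_iff.2 <| of_le_of ·)
  obtain ⟨g, hg⟩ := exists_mem_of_isChain hρ.commute hchain
  refine ⟨g, orderIso_ext fun x j => ?_⟩
  have hx : x ∈ Subgroup.closure (ρ '' Set.univ) := by
    rw [Set.image_univ, hρ.generate]
    trivial
  rw [leftMulHom_apply, leftMul_of]
  refine (closure_image_induction_right (p := fun x => ∀ j, f (of ρ x j) = of ρ (g * x) j)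
    hρ.mul_self (fun j => ?_) (fun x i _ ih => ?_) hx j).symm
  · have hj := mem_iff_of_eq.1 (hg (f (of ρ 1 j)) ⟨j, rfl⟩)
    rwa [idx_orderIso, of_idx, eq_comm, ← mul_one g] at hj
  · simpa only [mul_assoc] using hρ.orderIso_of_mul_gen ih i

/-- The identification of a string C-group with the automorphism group of its polytope, by the
action by left multiplication. -/
noncomputable def automorphismEquiv : Γ ≃* (CosetFace ρ ≃o CosetFace ρ) :=
  MulEquiv.ofBijective (leftMulHom ρ) ⟨hρ.leftMulHom_injective, hρ.leftMulHom_surjective⟩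

end IsStringCGroup

/-! ### The intersection property -/

section Intersection

variable {ι Γ : Type*} [Group Γ] {ρ : ι → Γ}

/-- The intersection property for subfamilies of the generators with index in `S`. -/
def IntersectionOn (ρ : ι → Γ) (S : Set ι) : Prop :=
  ∀ I ⊆ S, ∀ J ⊆ S,
    Subgroup.closure (ρ '' I) ⊓ Subgroup.closure (ρ '' J) ≤ Subgroup.closure (ρ '' (I ∩ J))

theorem IntersectionOn.mem_inter {S A B M : Set ι} (hS : IntersectionOn ρ S) (hA : A ⊆ S)
    (hB : B ⊆ S) (hM : M ⊆ S) (hAM : Disjoint A M) (hc : ∀ i ∈ A, ∀ j ∈ M, Commute (ρ i) (ρ j))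
    {x z : Γ} (hx : x ∈ Subgroup.closure (ρ '' A)) (hz : z ∈ Subgroup.closure (ρ '' B))
    (hzx : z⁻¹ * x ∈ Subgroup.closure (ρ '' M)) :
    x ∈ Subgroup.closure (ρ '' (B ∩ A)) ∧ z⁻¹ * x ∈ Subgroup.closure (ρ '' (B ∩ M)) := by
  have hz' : z ∈ Subgroup.closure (ρ '' (A ∪ M)) := by
    rw [show z = x * (z⁻¹ * x)⁻¹ by group]
    exact mul_mem (closure_image_mono Set.subset_union_left hx)
      (inv_mem (closure_image_mono Set.subset_union_right hzx))
  have hBAM := hS B hB (A ∪ M) (Set.union_subset hA hM) ⟨hz, hz'⟩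
  rw [Set.inter_union_distrib_left] at hBAM
  obtain ⟨u, hu, v, hv, rfl⟩ :=
    exists_mul_of_mem_closure_image_union (fun i hi j hj => hc i hi.2 j hj.2) hBAM
  have hux : u⁻¹ * x = 1 := by
    have hux_mem : u⁻¹ * x ∈ Subgroup.closure (ρ '' A) ⊓ Subgroup.closure (ρ '' M) := by
      refine ⟨Subgroup.mul_mem _ (inv_mem (closure_image_mono Set.inter_subset_right hu)) hx, ?_⟩
      rw [show u⁻¹ * x = v * ((u * v)⁻¹ * x) by group]
      exact mul_mem (closure_image_mono Set.inter_subset_right hv) hzx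
    simpa [hAM.inter_eq] using hS A hA M hM hux_mem
  obtain rfl : u = x := inv_mul_eq_one.1 hux
  refine ⟨hu, ?_⟩
  rw [show (u * v)⁻¹ * u = v⁻¹ by group]
  exact inv_mem hv

variable [LinearOrder ι]

theorem exists_mul_of_notMem (hc : ∀ i p j : ι, i < p → p < j → Commute (ρ i) (ρ j)) {K : Set ι}
    {p : ι} (hp : p ∉ K) {g : Γ} (hg : g ∈ Subgroup.closure (ρ '' K)) :
    ∃ x ∈ Subgroup.closure (ρ '' (K ∩ Set.Iio p)), ∃ y ∈ Subgroup.closure (ρ '' (K ∩ Set.Ioi p)),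
      g = x * y := by
  refine exists_mul_of_mem_closure_image_union (fun i hi j hj => hc i p j hi.2 hj.2) ?_
  rwa [← Set.inter_union_distrib_left, Set.Iio_union_Ioi,
    Set.inter_eq_left.2 (Set.subset_compl_singleton_iff.2 hp)]

section Icc

variable {a b p q : ι} (hlow : IntersectionOn ρ (Set.Ico a b))
  (hup : IntersectionOn ρ (Set.Ioc a b))
  (hmid : Subgroup.closure (ρ '' Set.Ico a b) ⊓ Subgroup.closure (ρ '' Set.Ioc a b) ≤
    Subgroup.closure (ρ '' Set.Ioo a b))
include hlow hup hmid

theorem closure_image_Ico_inf_Ioc_le (hap : a ≤ p) (hqb : q ≤ b) :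
    Subgroup.closure (ρ '' Set.Ico a q) ⊓ Subgroup.closure (ρ '' Set.Ioc p b) ≤
      Subgroup.closure (ρ '' Set.Ioo p q) := by
  rintro x ⟨hx, hx'⟩
  have hx_mid : x ∈ Subgroup.closure (ρ '' Set.Ioo a b) :=
    hmid ⟨closure_image_mono (Set.Ico_subset_Ico_right hqb) hx,
      closure_image_mono (Set.Ioc_subset_Ioc_left hap) hx'⟩
  have hx_low := hlow _ (Set.Ico_subset_Ico_right hqb) _ Set.Ioo_subset_Ico_self ⟨hx, hx_mid⟩
  have hx_up := hup _ (Set.inter_subset_right.trans Set.Ioo_subset_Ioc_self) _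
    (Set.Ioc_subset_Ioc_left hap) ⟨hx_low, hx'⟩
  refine closure_image_mono ?_ hx_up
  exact fun i hi => ⟨hi.2.1, hi.1.1.2⟩

theorem closure_image_inf_le_of_notMem (hc : ∀ i p j : ι, i < p → p < j → Commute (ρ i) (ρ j))
    {I J : Set ι} (hI : I ⊆ Set.Icc a b) (hJ : J ⊆ Set.Icc a b) (hap : a ≤ p) (hpq : p ≤ q)
    (hqb : q ≤ b) (hpI : p ∉ I) (hqJ : q ∉ J) :
    Subgroup.closure (ρ '' I) ⊓ Subgroup.closure (ρ '' J) ≤ Subgroup.closure (ρ '' (I ∩ J)) := by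
  rintro g ⟨hgI, hgJ⟩
  obtain ⟨x, hx, y, hy, hxy⟩ := exists_mul_of_notMem hc hpI hgI
  obtain ⟨z, hz, w, hw, hzw⟩ := exists_mul_of_notMem hc hqJ hgJ
  have hIlow : I ∩ Set.Iio p ⊆ Set.Ico a q := fun i hi => ⟨(hI hi.1).1, hi.2.trans_le hpq⟩
  have hIup : I ∩ Set.Ioi p ⊆ Set.Ioc p b := fun i hi => ⟨hi.2, (hI hi.1).2⟩
  have hJlow : J ∩ Set.Iio q ⊆ Set.Ico a q := fun i hi => ⟨(hJ hi.1).1, hi.2⟩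
  have hJup : J ∩ Set.Ioi q ⊆ Set.Ioc p b := fun i hi => ⟨hpq.trans_lt hi.2, (hJ hi.1).2⟩
  have hlow_sub : Set.Ico a q ⊆ Set.Ico a b := Set.Ico_subset_Ico_right hqb
  have hup_sub : Set.Ioc p b ⊆ Set.Ioc a b := Set.Ioc_subset_Ioc_left hap
  have hIoo_low : Set.Ioo p q ⊆ Set.Ico a b := fun i hi => ⟨hap.trans hi.1.le, hi.2.trans_le hqb⟩
  have hIoo_up : Set.Ioo p q ⊆ Set.Ioc a b := fun i hi => ⟨hap.trans_lt hi.1, hi.2.le.trans hqb⟩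
  have hm : z⁻¹ * x = w * y⁻¹ := by
    rw [inv_mul_eq_iff_eq_mul, ← mul_assoc, eq_mul_inv_iff_mul_eq, ← hxy, ← hzw]
  have hm_Ioo : z⁻¹ * x ∈ Subgroup.closure (ρ '' Set.Ioo p q) := by
    refine closure_image_Ico_inf_Ioc_le hlow hup hmid hap hqb ⟨?_, ?_⟩
    · exact Subgroup.mul_mem _ (inv_mem (closure_image_mono hJlow hz)) (closure_image_mono hIlow hx)
    · rw [hm]
      exact Subgroup.mul_mem _ (closure_image_mono hJup hw) (inv_mem (closure_image_mono hIup hy))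
  have hm' : y⁻¹⁻¹ * w⁻¹ = (z⁻¹ * x)⁻¹ := by rw [hm, mul_inv_rev]
  obtain ⟨hx', hmJ⟩ := hlow.mem_inter (hIlow.trans hlow_sub) (hJlow.trans hlow_sub) hIoo_low
    (Set.disjoint_left.2 fun i hi hi' => hi.2.not_gt hi'.1)
    (fun i hi j hj => hc i p j hi.2 hj.1) hx hz hm_Ioo
  obtain ⟨hw', hmI⟩ := hup.mem_inter (hJup.trans hup_sub) (hIup.trans hup_sub) hIoo_up
    (Set.disjoint_left.2 fun i hi hi' => hi.2.not_gt hi'.2)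
    (fun i hi j hj => (hc j q i hj.2 hi.2).symm) (inv_mem hw) (inv_mem hy)
    (hm' ▸ inv_mem hm_Ioo)
  rw [hm', inv_mem_iff] at hmI
  have hmIJ := hlow _ (Set.inter_subset_right.trans hIoo_low) _
    (Set.inter_subset_right.trans hIoo_low) ⟨hmI, hmJ⟩
  have hg : g = x * (z⁻¹ * x)⁻¹ * w := by rw [hm, hxy]; group
  rw [hg]
  refine mul_mem (mul_mem (closure_image_mono ?_ hx') (inv_mem (closure_image_mono ?_ hmIJ)))
    (inv_mem_iff.1 (closure_image_mono ?_ hw'))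
  · exact fun i hi => ⟨hi.2.1, hi.1.1⟩
  · exact fun i hi => ⟨hi.1.1.1, hi.2.1.1⟩
  · exact fun i hi => ⟨hi.1.1, hi.2.1⟩

theorem IntersectionOn.Icc (hc : ∀ i p j : ι, i < p → p < j → Commute (ρ i) (ρ j)) :
    IntersectionOn ρ (Set.Icc a b) := by
  intro I hI J hJ
  by_cases hIt : Set.Icc a b ⊆ I
  · rw [Set.inter_eq_right.2 (hJ.trans hIt)]
    exact inf_le_right
  by_cases hJt : Set.Icc a b ⊆ J
  · rw [Set.inter_eq_left.2 (hI.trans hJt)]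
    exact inf_le_left
  obtain ⟨p, hp, hpI⟩ := Set.not_subset.1 hIt
  obtain ⟨q, hq, hqJ⟩ := Set.not_subset.1 hJt
  rcases le_total p q with hpq | hqp
  · exact closure_image_inf_le_of_notMem hlow hup hmid hc hI hJ hp.1 hpq hq.2 hpI hqJ
  · rw [inf_comm, Set.inter_comm]
    exact closure_image_inf_le_of_notMem hlow hup hmid hc hJ hI hq.1 hqp hp.2 hqJ hpI

end Icc

variable [Finite ι] (hc : ∀ i p j : ι, i < p → p < j → Commute (ρ i) (ρ j))
  (h : ∀ k l : ι, k < l →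
    Subgroup.closure (ρ '' Set.Ico k l) ⊓ Subgroup.closure (ρ '' Set.Ioc k l) ≤
      Subgroup.closure (ρ '' Set.Ioo k l))
include hc h

theorem IntersectionOn.of_ordConnected {S : Set ι} (hS : S.OrdConnected) : IntersectionOn ρ S := by
  induction hcard : S.ncard using Nat.strong_induction_on generalizing S with
  | _ m ih =>
    subst hcard
    rcases S.eq_empty_or_nonempty with rfl | hne
    · intro I hI J _
      rw [Set.subset_empty_iff.1 hI, Set.empty_inter]
      exact inf_le_left
    obtain ⟨a, ha, hmin⟩ := S.exists_min_image id S.toFinite hne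
    obtain ⟨b, hb, hmax⟩ := S.exists_max_image id S.toFinite hne
    obtain rfl : S = Set.Icc a b :=
      Set.Subset.antisymm (fun i hi => ⟨hmin i hi, hmax i hi⟩) (hS.out ha hb)
    refine IntersectionOn.Icc ?_ ?_ ?_ hc
    · refine ih _ (Set.ncard_lt_ncard ?_) Set.ordConnected_Ico rfl
      exact ⟨Set.Ico_subset_Icc_self, fun hsub => (hsub hb).2.false⟩
    · refine ih _ (Set.ncard_lt_ncard ?_) Set.ordConnected_Ioc rfl
      exact ⟨Set.Ioc_subset_Icc_self, fun hsub => (hsub ha).1.false⟩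
    · rcases (hmin b hb : a ≤ b).eq_or_lt with rfl | hab
      · simp
      · exact h a b hab

theorem closure_image_inf_eq (I J : Set ι) :
    Subgroup.closure (ρ '' I) ⊓ Subgroup.closure (ρ '' J) = Subgroup.closure (ρ '' (I ∩ J)) :=
  le_antisymm
    (IntersectionOn.of_ordConnected hc h Set.ordConnected_univ I I.subset_univ J J.subset_univ)
    (le_inf (closure_image_mono Set.inter_subset_left) (closure_image_mono Set.inter_subset_right))

end Intersection

/-! ### Vertex-figures -/

section VertexFigure

open CosetFace

variable {n : ℕ} {Γ Γ' : Type*} [Group Γ] [Group Γ'] {ρ : Fin (n + 1) → Γ} {ρ' : Fin n → Γ'}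
  {φ : Γ' →* Γ} (hφ : ∀ i, φ (ρ' i) = ρ i.succ)
include hφ

theorem faceSubgroup_one_eq_range (hgen : Subgroup.closure (Set.range ρ') = ⊤) :
    faceSubgroup ρ 1 = φ.range := by
  have hsucc : {i : Fin (n + 1) | (i : ℕ) + 1 ≠ (1 : Fin (n + 3))} = Fin.succ '' Set.univ := by
    ext i
    rw [Set.image_univ, Fin.range_succ, Set.mem_ofPred_eq, Set.mem_compl_singleton_iff, Ne, Ne,
      Fin.ext_iff, Fin.val_one, Fin.val_zero]
    omega
  rw [faceSubgroup, hsucc, ← map_closure_image hφ, Set.image_univ, hgen, MonoidHom.range_eq_map]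

namespace IsStringCGroup

variable (hρ : IsStringCGroup ρ) (hgen : Subgroup.closure (Set.range ρ') = ⊤)
  (hinj : Function.Injective φ)
include hρ hgen hinj

theorem map_mem_faceSubgroup_succ_iff {j : Fin (n + 2)} {x : Γ'} :
    φ x ∈ faceSubgroup ρ j.succ ↔ x ∈ faceSubgroup ρ' j := by
  have hone : φ x ∈ faceSubgroup ρ 1 := by
    rw [faceSubgroup_one_eq_range hφ hgen]
    exact ⟨x, rfl⟩
  have hinf : φ x ∈ faceSubgroup ρ j.succ ↔ φ x ∈ faceSubgroup ρ 1 ⊓ faceSubgroup ρ j.succ :=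
    (and_iff_right hone).symm
  have hsucc : {i : Fin (n + 1) | (i : ℕ) + 1 ≠ (1 : Fin (n + 3))} ∩
      {i : Fin (n + 1) | (i : ℕ) + 1 ≠ j.succ} = Fin.succ '' {i : Fin n | (i : ℕ) + 1 ≠ j} := by
    ext i
    refine Fin.cases ?_ (fun i => ?_) i <;> simp
  rw [hinf, faceSubgroup, faceSubgroup, hρ.intersection, hsucc, map_mem_closure_image_iff hφ hinj,
    faceSubgroup]

theorem nonempty_vertexFigure_iso {F : CosetFace ρ} (hF : F.rk = 0) :
    Nonempty ({H // F ≤ H} ≃o CosetFace ρ') := by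
  obtain ⟨e⟩ := F.nonempty_upper_iso
  rw [show F.idx = 1 from Fin.ext (by simp only [CosetFace.rk] at hF; rw [Fin.val_one]; omega)] at e
  have hbase {g : Γ} (hg : g ∈ of ρ 1 1) : ∃ x, φ x = g := by
    rwa [mem_of_iff, inv_one, one_mul, faceSubgroup_one_eq_range hφ hgen] at hg
  have hφ_base (x : Γ') : φ x ∈ of ρ 1 1 := by
    rw [mem_of_iff, inv_one, one_mul, faceSubgroup_one_eq_range hφ hgen]
    exact ⟨x, rfl⟩
  choose r hr using fun K : CosetFace ρ' => K.exists_mem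
  let f (K : CosetFace ρ') : {H // of ρ 1 1 ≤ H} := ⟨of ρ (φ (r K)) K.idx.succ,
    le_of_mem (hφ_base _) (mem_of _ _) (by simp [Fin.le_def])⟩
  have hf {K : CosetFace ρ'} {x : Γ'} : φ x ∈ (f K).1 ↔ x ∈ K := by
    rw [mem_of_iff, ← map_inv, ← map_mul, hρ.map_mem_faceSubgroup_succ_iff hφ hgen hinj,
      ← mem_of_iff, mem_iff_of_eq.1 (hr K)]
  have hf_le {K L : CosetFace ρ'} : f K ≤ f L ↔ K ≤ L := by
    constructor
    · intro h
      obtain ⟨g, hg, hgK, hgL⟩ := exists_mem_of_le_of_le hρ.commute (f K).2 h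
      obtain ⟨x, rfl⟩ := hbase hg
      exact le_of_mem (hf.1 hgK) (hf.1 hgL) (Fin.succ_le_succ_iff.1 h.1)
    · rintro ⟨hi, x, hK, hL⟩
      exact le_of_mem (hf.2 hK) (hf.2 hL) (Fin.succ_le_succ_iff.2 hi)
  have hf_inj : Function.Injective f := fun K L h =>
    CosetFace.le_antisymm (hf_le.1 (h ▸ refl _)) (hf_le.1 (h ▸ refl _))
  have hf_surj : Function.Surjective f := by
    rintro ⟨H, hH⟩
    obtain ⟨hi, g, hg, hgH⟩ := id hH
    obtain ⟨x, rfl⟩ := hbase hg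
    have hidx : H.idx ≠ 0 := fun h0 => by simp [h0] at hi
    refine ⟨of ρ' x (H.idx.pred hidx), Subtype.ext (eq_of_mem (hf.2 (mem_of _ _)) hgH ?_)⟩
    exact Fin.succ_pred _ hidx
  exact ⟨e.trans (RelIso.symm ⟨Equiv.ofBijective f ⟨hf_inj, hf_surj⟩, hf_le⟩)⟩

end IsStringCGroup

end VertexFigure

/-! ### Rewriting words in a monoid -/

section Rewriting

variable {ι M : Type*} [DecidableEq ι] [Monoid M]

/-- Reduce the word `out.reverse ++ inp` by the rewriting rules `R`, with a bound on the number of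
steps; `out` is the part already reduced. -/
def rewriteWord (R : List (List ι × List ι)) : ℕ → List ι → List ι → List ι
  | 0, out, inp => out.reverse ++ inp
  | _ + 1, out, [] => out.reverse
  | k + 1, out, i :: inp =>
    match R.find? fun r => r.1.reverse.isPrefixOf (i :: out) with
    | none => rewriteWord R k (i :: out) inp
    | some r => rewriteWord R k ((i :: out).drop r.1.length) (r.2 ++ inp)

theorem prod_map_rewriteWord {s : ι → M} {R : List (List ι × List ι)}
    (hR : ∀ r ∈ R, (r.1.map s).prod = (r.2.map s).prod) (k : ℕ) (out inp : List ι) :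
    ((rewriteWord R k out inp).map s).prod = ((out.reverse ++ inp).map s).prod := by
  induction k generalizing out inp with
  | zero => rfl
  | succ k ih =>
    cases inp with
    | nil => rw [rewriteWord, List.append_nil]
    | cons i inp =>
      rw [rewriteWord]
      split
      · rw [ih, List.reverse_cons, List.append_assoc, List.singleton_append]
      · next r hr =>
        have hfound := List.find?_some (p := fun r : List ι × List ι =>
          r.1.reverse.isPrefixOf (i :: out)) hr
        obtain ⟨t, ht⟩ := List.isPrefixOf_iff_prefix.1 hfound
        have hdrop : (i :: out).drop r.1.length = t := by
          rw [← ht, List.drop_left' r.1.length_reverse]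
        have hout : out.reverse ++ i :: inp = t.reverse ++ r.1 ++ inp := by
          rw [← List.singleton_append, ← List.append_assoc, ← List.reverse_cons, ← ht,
            List.reverse_append, List.reverse_reverse]
        rw [ih, hdrop, hout]
        simp only [List.map_append, List.prod_append, hR r (List.mem_of_find?_eq_some hr),
          mul_assoc]

/-- Each rule `(u, v, x)` of the list follows from the earlier ones, since they reduce `u x` and
`v x` to the same word. -/
def checkRules (k : ℕ) : List (List ι × List ι) → List (List ι × List ι × ι) → Bool
  | _, [] => true
  | R, (u, v, x) :: rs =>
    (rewriteWord R k [] (u ++ [x]) == rewriteWord R k [] (v ++ [x])) &&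
      checkRules k (R ++ [(u, v)]) rs

theorem prod_map_eq_of_checkRules [IsRightCancelMul M] {s : ι → M} (k : ℕ)
    (rs : List (List ι × List ι × ι)) (R : List (List ι × List ι))
    (hR : ∀ r ∈ R, (r.1.map s).prod = (r.2.map s).prod) (h : checkRules k R rs = true) :
    ∀ r ∈ R ++ rs.map fun r => (r.1, r.2.1), (r.1.map s).prod = (r.2.map s).prod := by
  induction rs generalizing R with
  | nil => simpa using hR
  | cons r rs ih =>
    obtain ⟨u, v, x⟩ := r
    simp only [checkRules, Bool.and_eq_true, beq_iff_eq] at h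
    obtain ⟨hred, hrest⟩ := h
    have huv : (u.map s).prod = (v.map s).prod := by
      have hx := congrArg (fun w => (w.map s).prod) hred
      simpa [prod_map_rewriteWord hR] using hx
    have hR' : ∀ r ∈ R ++ [(u, v)], (r.1.map s).prod = (r.2.map s).prod :=
      List.forall_mem_append.2 ⟨hR, List.forall_mem_singleton.2 huv⟩
    simpa using ih _ hR' hrest

end Rewriting

/-! ### The Coxeter group of type `F₄` -/

namespace Cell24

open CoxeterMatrix

/-- The product of the simple reflections along a word. -/
abbrev wordProd (w : List (Fin 4)) : F₄.Group := (w.map F₄.simple).prod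

/-- The defining relations of `F₄` as rewriting rules. -/
def baseRules : List (List (Fin 4) × List (Fin 4)) :=
  [([0, 0], []), ([1, 1], []), ([2, 2], []), ([3, 3], []), ([2, 0], [0, 2]), ([3, 0], [0, 3]),
    ([3, 1], [1, 3]), ([1, 0, 1], [0, 1, 0]), ([3, 2, 3], [2, 3, 2]),
    ([2, 1, 2, 1], [1, 2, 1, 2])]

/-- The further rules of a complete rewriting system. -/
def derivedRules : List (List (Fin 4) × List (Fin 4) × Fin 4) :=
  [([3, 2, 1, 3], [2, 3, 2, 1], 1),
    ([3, 2, 1, 0, 3], [2, 3, 2, 1, 0], 0),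
    ([2, 1, 0, 2, 1, 0], [1, 2, 1, 0, 2, 1], 1),
    ([3, 2, 1, 2, 3, 2], [2, 3, 2, 1, 2, 3], 3),
    ([3, 2, 1, 0, 2, 3, 2], [2, 3, 2, 1, 0, 2, 3], 0),
    ([3, 2, 1, 0, 2, 1, 3, 2, 1, 2], [2, 3, 2, 1, 0, 2, 1, 3, 2, 1], 1),
    ([3, 2, 1, 0, 2, 1, 3, 2, 1, 0, 2], [2, 3, 2, 1, 0, 2, 1, 3, 2, 1, 0], 0),
    ([3, 2, 1, 0, 2, 1, 2, 3, 2, 1, 2, 3], [2, 3, 2, 1, 0, 2, 1, 2, 3, 2, 1, 2], 2),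
    ([3, 2, 1, 0, 2, 1, 2, 3, 2, 1, 0, 2, 3], [2, 3, 2, 1, 0, 2, 1, 2, 3, 2, 1, 0, 2], 0),
    ([3, 2, 1, 0, 2, 1, 2, 3, 2, 1, 0, 2, 1, 3], [2, 3, 2, 1, 0, 2, 1, 2, 3, 2, 1, 0, 2, 1], 1),
    ([3, 2, 1, 0, 2, 1, 2, 3, 2, 1, 0, 2, 1, 2, 3, 2],
      [2, 3, 2, 1, 0, 2, 1, 2, 3, 2, 1, 0, 2, 1, 2, 3], 3)]

theorem simple_mul_self (i : Fin 4) : F₄.simple i * F₄.simple i = 1 :=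
  F₄.toCoxeterSystem.simple_mul_simple_self i

theorem wordProd_eq_of_mem_baseRules : ∀ r ∈ baseRules, wordProd r.1 = wordProd r.2 := by
  have square (i : Fin 4) : wordProd [i, i] = wordProd [] := by
    simp [wordProd, simple_mul_self]
  have braid := F₄.toCoxeterSystem.wordProd_braidWord_eq
  simp only [baseRules, List.forall_mem_cons, List.not_mem_nil, false_imp_iff, implies_true,
    and_true]
  exact ⟨square 0, square 1, square 2, square 3, (braid 0 2).symm, (braid 0 3).symm,
    (braid 1 3).symm, braid 0 1, braid 2 3, (braid 1 2).symm⟩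

/-- A complete rewriting system for `F₄`. -/
def rules : List (List (Fin 4) × List (Fin 4)) :=
  baseRules ++ derivedRules.map fun r => (r.1, r.2.1)

theorem wordProd_eq_of_mem_rules : ∀ r ∈ rules, wordProd r.1 = wordProd r.2 :=
  prod_map_eq_of_checkRules 60 derivedRules baseRules wordProd_eq_of_mem_baseRules
    (by decide +kernel)

/-- The minimal representatives of the left cosets of `⟨s_0, …, s_{l-1}⟩` in `⟨s_0, …, s_l⟩`. -/
def cosetWords : Fin 4 → List (List (Fin 4)) :=
  ![[[], [0]],
    [[], [1], [0, 1]],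
    [[], [2], [1, 2], [0, 1, 2], [2, 1, 2], [0, 2, 1, 2], [1, 0, 2, 1, 2], [2, 1, 0, 2, 1, 2]],
    [[], [3], [2, 3], [1, 2, 3], [0, 1, 2, 3], [2, 1, 2, 3], [0, 2, 1, 2, 3], [3, 2, 1, 2, 3],
      [1, 0, 2, 1, 2, 3], [0, 3, 2, 1, 2, 3], [2, 1, 0, 2, 1, 2, 3], [1, 0, 3, 2, 1, 2, 3],
      [3, 2, 1, 0, 2, 1, 2, 3], [2, 1, 0, 3, 2, 1, 2, 3], [2, 3, 2, 1, 0, 2, 1, 2, 3],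
      [1, 2, 1, 0, 3, 2, 1, 2, 3], [1, 2, 3, 2, 1, 0, 2, 1, 2, 3],
      [0, 1, 2, 1, 0, 3, 2, 1, 2, 3], [0, 1, 2, 3, 2, 1, 0, 2, 1, 2, 3],
      [2, 1, 2, 3, 2, 1, 0, 2, 1, 2, 3], [0, 2, 1, 2, 3, 2, 1, 0, 2, 1, 2, 3],
      [1, 0, 2, 1, 2, 3, 2, 1, 0, 2, 1, 2, 3], [2, 1, 0, 2, 1, 2, 3, 2, 1, 0, 2, 1, 2, 3],
      [3, 2, 1, 0, 2, 1, 2, 3, 2, 1, 0, 2, 1, 2, 3]]]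

/-- Reduction of words by `rules`. The bound of 60 steps suffices for all the words that occur. -/
abbrev normalForm (w : List (Fin 4)) : List (Fin 4) := rewriteWord rules 60 [] w

theorem wordProd_normalForm (w : List (Fin 4)) : wordProd (normalForm w) = wordProd w :=
  prod_map_rewriteWord wordProd_eq_of_mem_rules 60 [] w

theorem wordProd_eq_of_normalForm_eq {u v : List (Fin 4)} (h : normalForm u = normalForm v) :
    wordProd u = wordProd v := by
  rw [← wordProd_normalForm u, h, wordProd_normalForm]

theorem exists_normalForm_cons_eq : ∀ l k : Fin 4, ∀ w ∈ cosetWords l, (∀ i ∈ w, k ≤ i) →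
    ∀ i, k ≤ i → i ≤ l → ∃ w' ∈ cosetWords l, (∀ i ∈ w', k ≤ i) ∧
      (normalForm (i :: w) = normalForm w' ∨
        ∃ j, k ≤ j ∧ j < l ∧ normalForm (i :: w) = normalForm (w' ++ [j])) := by
  decide +kernel

theorem exists_eq_wordProd_mul (k l : Fin 4) {w : F₄.Group}
    (hw : w ∈ Subgroup.closure (F₄.simple '' Set.Icc k l)) :
    ∃ f ∈ cosetWords l, (∀ i ∈ f, k ≤ i) ∧
      ∃ b ∈ Subgroup.closure (F₄.simple '' Set.Ico k l), w = wordProd f * b := by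
  refine closure_image_induction_left simple_mul_self (p := fun w => ∃ f ∈ cosetWords l,
    (∀ i ∈ f, k ≤ i) ∧ ∃ b ∈ Subgroup.closure (F₄.simple '' Set.Ico k l), w = wordProd f * b)
    ?_ ?_ hw
  · have hnil : ∀ l, [] ∈ cosetWords l := by decide
    exact ⟨[], hnil l, by simp, 1, one_mem _, by simp [wordProd]⟩
  · rintro x i ⟨hki, hil⟩ ⟨f, hf, hfk, b, hb, rfl⟩
    obtain ⟨f', hf', hfk', h | ⟨j, hkj, hjl, h⟩⟩ := exists_normalForm_cons_eq l k f hf hfk i hki hil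
    · refine ⟨f', hf', hfk', b, hb, ?_⟩
      rw [← wordProd_eq_of_normalForm_eq h]
      simp [wordProd, mul_assoc]
    · refine ⟨f', hf', hfk', F₄.simple j * b,
        mul_mem (mem_closure_image_of_mem ⟨hkj, hjl⟩) hb, ?_⟩
      have hif : F₄.simple i * wordProd f = wordProd f' * F₄.simple j := by
        simpa [wordProd] using wordProd_eq_of_normalForm_eq h
      rw [← mul_assoc, hif, mul_assoc]

end Cell24

/-! ### The modular reflection groups -/

open Matrix in
theorem vecMul_reduce_rootReflection {n : ℕ} (a : Fin n → ℕ) (d : ℕ) (i : Fin n)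
    (y : Fin n → ZMod d) :
    y ᵥ* (reduce n d (rootReflection a i)).val =
      fun j => y j + y i * (cartanInt a i j : ZMod d) := by
  have h : (reduce n d (rootReflection a i)).val =
      1 + vecMulVec (Pi.single i 1) (fun j => (cartanInt a i j : ZMod d)) := by
    ext k j
    simp only [reduce, GeneralLinearGroup.map_apply, rootReflection, reflMatrix, Matrix.add_apply,
      vecMulVec_apply, Pi.single_apply, one_apply]
    split_ifs <;> simp
  rw [h, vecMul_add, vecMul_one, vecMul_vecMulVec]
  ext j
  simp

namespace modGroup

open Matrix

variable {n : ℕ} {a : Fin n → ℕ} {d : ℕ}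

theorem coe_modGen (i : Fin n) :
    (modGen a d i : GeneralLinearGroup (Fin n) (ZMod d)) = reduce n d (rootReflection a i) := rfl

theorem modGen_mul_self (i : Fin n) : modGen a d i * modGen a d i = 1 := by
  have h : rootReflection a i * rootReflection a i = 1 := Units.ext (reflMatrix_mul_self a i)
  apply Subtype.ext
  rw [Subgroup.coe_mul, coe_modGen, ← map_mul, h, map_one, Subgroup.coe_one]

theorem closure_range_modGen : Subgroup.closure (Set.range (modGen a d)) = ⊤ := by
  apply Subgroup.map_injective (modGroup a d).subtype_injective
  rw [MonoidHom.map_closure, ← MonoidHom.range_eq_map, Subgroup.range_subtype, ← Set.range_comp]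
  change _ = (Subgroup.closure (Set.range (rootReflection a))).map (reduce n d)
  rw [MonoidHom.map_closure, ← Set.range_comp]
  rfl

theorem single_vecMul_of_mem_closure {S : Set (Fin n)} {l : Fin n} (hl : l ∉ S)
    {g : modGroup a d} (hg : g ∈ Subgroup.closure (modGen a d '' S)) :
    (Pi.single l 1 : Fin n → ZMod d) ᵥ* g.1.val = Pi.single l 1 := by
  refine closure_image_induction_right modGen_mul_self
    (p := fun g => (Pi.single l 1 : Fin n → ZMod d) ᵥ* g.1.val = Pi.single l 1) (by simp)
    (fun x i hi hx => ?_) hg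
  have hil : i ≠ l := fun h => hl (h ▸ hi)
  rw [Subgroup.coe_mul, Units.val_mul, ← vecMul_vecMul, hx, coe_modGen,
    vecMul_reduce_rootReflection]
  simp [hil]

theorem modGen_ne_one (hd : 2 < d) (i : Fin n) : modGen a d i ≠ 1 := by
  intro h
  have hrow : (Pi.single i 1 : Fin n → ZMod d) ᵥ* (modGen a d i).1.val = Pi.single i 1 := by
    rw [h]
    simp
  rw [coe_modGen, vecMul_reduce_rootReflection] at hrow
  have hii := congrFun hrow i
  simp only [Pi.single_eq_same, one_mul, add_eq_left, cartanInt, if_true] at hii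
  rw [ZMod.intCast_zmod_eq_zero_iff_dvd] at hii
  have := Int.le_of_dvd (by norm_num) (dvd_neg.1 hii)
  omega

theorem reflMatrix_commute {i j : Fin n} (hij : (i : ℕ) + 2 ≤ j) :
    Commute (reflMatrix a i) (reflMatrix a j) := by
  have hij_zero : cartanInt a i j = 0 := by
    rw [cartanInt, if_neg (by omega), if_neg (by omega)]
  have hji_zero : cartanInt a j i = 0 := by
    rw [cartanInt, if_neg (by omega), if_neg (by omega)]
  have hprod {p q : Fin n} (h : cartanInt a p q = 0) :
      vecMulVec (Pi.single p 1) (cartanInt a p) * vecMulVec (Pi.single q 1) (cartanInt a q) =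
        0 := by
    rw [vecMulVec_mul_vecMulVec, dotProduct_single, h, zero_mul, zero_smul, vecMulVec_zero]
  rw [Commute, SemiconjBy]
  simp only [reflMatrix, mul_add, add_mul, one_mul, mul_one, hprod hij_zero, hprod hji_zero]
  abel

theorem modGen_commute (i j : Fin n) (hij : (i : ℕ) + 2 ≤ j) :
    Commute (modGen a d i) (modGen a d j) := by
  have h : Commute (rootReflection a i) (rootReflection a j) :=
    Units.ext (reflMatrix_commute hij).eq
  exact Subtype.ext (h.map (reduce n d)).eq

end modGroup

/-! ### The vertex-figure group -/

namespace BasicSystem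

open Matrix CoxeterMatrix modGroup

instance : Fintype BasicSystem := ⟨{.a, .b, .c, .d}, fun D => by cases D <;> simp⟩

theorem reflMatrix_pow_eq_one : ∀ (D : BasicSystem) (i j : Fin 4),
    (reflMatrix D.labels i.succ * reflMatrix D.labels j.succ) ^ F₄ i j = 1 := by
  decide +kernel

variable (D : BasicSystem) (d : ℕ)

theorem isLiftable_modGen : F₄.IsLiftable fun i : Fin 4 => modGen D.labels d i.succ := by
  intro i j
  have h : (rootReflection D.labels i.succ * rootReflection D.labels j.succ) ^ F₄ i j = 1 :=
    Units.ext (D.reflMatrix_pow_eq_one i j)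
  apply Subtype.ext
  rw [Subgroup.coe_pow, Subgroup.coe_mul, coe_modGen, coe_modGen, ← map_mul, ← map_pow, h, map_one,
    Subgroup.coe_one]

/-- The homomorphism from the Coxeter group `F₄` onto the group of the base vertex. -/
noncomputable def vertexHom : F₄.Group →* modGroup D.labels d :=
  F₄.toCoxeterSystem.lift ⟨fun i => modGen D.labels d i.succ, D.isLiftable_modGen d⟩

theorem vertexHom_simple (i : Fin 4) : D.vertexHom d (F₄.simple i) = modGen D.labels d i.succ :=
  F₄.toCoxeterSystem.lift_apply_simple (D.isLiftable_modGen d) i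

/-- The action of a word of reflections on an integral row vector. -/
def rowWord (a : Fin 5 → ℕ) (y : Fin 5 → ℤ) : List (Fin 4) → Fin 5 → ℤ
  | [] => y
  | i :: w => rowWord a (fun j => y j + y i.succ * cartanInt a i.succ j) w

theorem vecMul_vertexHom_wordProd (y : Fin 5 → ℤ) (w : List (Fin 4)) :
    (fun j => (y j : ZMod d)) ᵥ* (D.vertexHom d (Cell24.wordProd w)).1.val =
      fun j => (rowWord D.labels y w j : ZMod d) := by
  induction w generalizing y with
  | nil => simp [Cell24.wordProd, rowWord]
  | cons i w ih =>
    rw [Cell24.wordProd, List.map_cons, List.prod_cons, map_mul, Subgroup.coe_mul, Units.val_mul,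
      ← vecMul_vecMul, vertexHom_simple, coe_modGen, vecMul_reduce_rootReflection, rowWord, ← ih]
    congr 1
    ext j
    push_cast
    rfl

/-- Differences of absolute value `1` or `2` survive reduction modulo every `d > 2`. -/
theorem exists_natAbs_rowWord_sub_mem : ∀ (D : BasicSystem) (l : Fin 4),
    ∀ w ∈ Cell24.cosetWords l, w ≠ [] →
      ∃ j, (rowWord D.labels (Pi.single l.succ 1) w j -
        (Pi.single l.succ 1 : Fin 5 → ℤ) j).natAbs ∈ [1, 2] := by
  decide +kernel

variable {d}

theorem single_vecMul_vertexHom_wordProd_ne (hd : 2 < d) {l : Fin 4} {f : List (Fin 4)}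
    (hf : f ∈ Cell24.cosetWords l) (hnil : f ≠ []) :
    (Pi.single l.succ 1 : Fin 5 → ZMod d) ᵥ* (D.vertexHom d (Cell24.wordProd f)).1.val ≠
      Pi.single l.succ 1 := by
  intro hfix
  obtain ⟨j, hj⟩ := exists_natAbs_rowWord_sub_mem D l f hf hnil
  have hcast : (Pi.single l.succ 1 : Fin 5 → ZMod d) =
      fun j => ((Pi.single l.succ 1 : Fin 5 → ℤ) j : ZMod d) := by
    ext j
    simp only [Pi.single_apply]
    split_ifs <;> simp
  rw [hcast, vecMul_vertexHom_wordProd] at hfix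
  have hdvd := congrFun hfix j
  rw [← sub_eq_zero, ← Int.cast_sub, ZMod.intCast_zmod_eq_zero_iff_dvd, ← Int.natAbs_dvd_natAbs,
    Int.natAbs_natCast] at hdvd
  simp only [List.mem_cons, List.not_mem_nil, or_false] at hj
  have := Nat.le_of_dvd (by omega) hdvd
  omega

theorem mem_closure_of_single_vecMul (hd : 2 < d) {k l : Fin 4} {w : F₄.Group}
    (hw : w ∈ Subgroup.closure (F₄.simple '' Set.Icc k l))
    (hfix : (Pi.single l.succ 1 : Fin 5 → ZMod d) ᵥ* (D.vertexHom d w).1.val = Pi.single l.succ 1) :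
    w ∈ Subgroup.closure (F₄.simple '' Set.Ico k l) := by
  obtain ⟨f, hf, -, b, hb, rfl⟩ := Cell24.exists_eq_wordProd_mul k l hw
  have hbfix : (Pi.single l.succ 1 : Fin 5 → ZMod d) ᵥ* (D.vertexHom d b⁻¹).1.val =
      Pi.single l.succ 1 := by
    refine single_vecMul_of_mem_closure (S := Fin.succ '' Set.Ico k l) (by simp) ?_
    rw [← map_closure_image (D.vertexHom_simple d)]
    exact Subgroup.mem_map_of_mem _ (inv_mem hb)
  have hffix : (Pi.single l.succ 1 : Fin 5 → ZMod d) ᵥ*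
      (D.vertexHom d (Cell24.wordProd f)).1.val = Pi.single l.succ 1 := by
    rw [← mul_inv_cancel_right (Cell24.wordProd f) b, map_mul, Subgroup.coe_mul, Units.val_mul,
      ← vecMul_vecMul, hfix, hbfix]
  have hnil : f = [] := by
    by_contra hnil
    exact D.single_vecMul_vertexHom_wordProd_ne hd hf hnil hffix
  simpa [hnil, Cell24.wordProd] using hb

theorem vertexHom_injective (hd : 2 < d) : Function.Injective (D.vertexHom d) := by
  rw [injective_iff_map_eq_one]
  intro w hw
  have hfix (l : Fin 4) : (Pi.single l.succ 1 : Fin 5 → ZMod d) ᵥ* (D.vertexHom d w).1.val =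
      Pi.single l.succ 1 := by
    rw [hw]
    simp
  have hIcc (l : Fin 4) : w ∈ Subgroup.closure (F₄.simple '' Set.Icc 0 l) := by
    induction l using Fin.reverseInduction with
    | last =>
      have htop : Subgroup.closure (Set.range F₄.simple) = ⊤ :=
        F₄.toCoxeterSystem.subgroup_closure_range_simple
      have huniv : Set.Icc (0 : Fin 4) (Fin.last 3) = Set.univ :=
        Set.eq_univ_of_forall fun i => ⟨Fin.zero_le i, Fin.le_last i⟩
      rw [huniv, Set.image_univ, htop]
      exact Subgroup.mem_top w
    | cast l ih =>
      refine closure_image_mono (fun i hi => ?_) (D.mem_closure_of_single_vecMul hd ih (hfix _))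
      exact ⟨hi.1, Fin.le_castSucc_iff.2 hi.2⟩
  simpa using D.mem_closure_of_single_vecMul hd (hIcc 0) (hfix 0)

theorem closure_image_Ico_inf_Ioc_le_Ioo (hd : 2 < d) {k l : Fin 5} (hkl : k < l) :
    Subgroup.closure (modGen D.labels d '' Set.Ico k l) ⊓
        Subgroup.closure (modGen D.labels d '' Set.Ioc k l) ≤
      Subgroup.closure (modGen D.labels d '' Set.Ioo k l) := by
  rintro g ⟨hIco, hIoc⟩
  obtain ⟨k, rfl⟩ := Fin.exists_castSucc_eq.2 (Fin.ne_last_of_lt hkl)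
  obtain ⟨l, rfl⟩ := Fin.exists_succ_eq.2 (Fin.ne_zero_of_lt hkl)
  have hIcc_eq : Set.Ioc k.castSucc l.succ = Fin.succ '' Set.Icc k l := by
    rw [Fin.image_succ_Icc]
    ext i
    rw [Set.mem_Ioc, Set.mem_Icc, Fin.castSucc_lt_iff_succ_le]
  have hIco_eq : Set.Ioo k.castSucc l.succ = Fin.succ '' Set.Ico k l := by
    rw [Fin.image_succ_Ico]
    ext i
    rw [Set.mem_Ioo, Set.mem_Ico, Fin.castSucc_lt_iff_succ_le]
  rw [hIcc_eq, ← map_closure_image (D.vertexHom_simple d)] at hIoc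
  obtain ⟨w, hw, rfl⟩ := hIoc
  rw [hIco_eq, ← map_closure_image (D.vertexHom_simple d)]
  exact Subgroup.mem_map_of_mem _
    (D.mem_closure_of_single_vecMul hd hw (single_vecMul_of_mem_closure (by simp) hIco))

theorem isStringCGroup (hd : 2 < d) : IsStringCGroup (modGen D.labels d) where
  generate := closure_range_modGen
  involution i := orderOf_eq_prime (by rw [pow_two, modGen_mul_self]) (modGen_ne_one hd i)
  commute := modGen_commute
  intersection := closure_image_inf_eq (fun i p j hip hpj => modGen_commute i j (by omega))
    fun _ _ => D.closure_image_Ico_inf_Ioc_le_Ioo hd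

end BasicSystem

/-! ### The symmetries of the cubical tessellation -/

/-- The symmetry `x ↦ v + ε · (x ∘ σ⁻¹)` of the tessellation of `m`-space by unit cubes, where `σ`
permutes the coordinates and `ε` is a choice of signs. The origin is the center of a cube, so that
the vertices have the coordinates in `1/2 + ℤ`. -/
@[ext]
structure CubeSym (m : ℕ) where
  v : Fin m → ℤ
  ε : Fin m → ℤˣ
  σ : Equiv.Perm (Fin m)

namespace CubeSym

variable {m : ℕ}

instance : DecidableEq (CubeSym m) := fun _ _ => decidable_of_iff _ CubeSym.ext_iff.symm

instance : Mul (CubeSym m) where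
  mul a b :=
    ⟨fun i => a.v i + a.ε i * b.v (a.σ.symm i), fun i => a.ε i * b.ε (a.σ.symm i), a.σ * b.σ⟩

instance : One (CubeSym m) where
  one := ⟨0, 1, 1⟩

instance : Inv (CubeSym m) where
  inv a := ⟨fun i => -(a.ε (a.σ i) * a.v (a.σ i)), fun i => a.ε (a.σ i), a.σ.symm⟩

theorem mul_def (a b : CubeSym m) : a * b =
    ⟨fun i => a.v i + a.ε i * b.v (a.σ.symm i), fun i => a.ε i * b.ε (a.σ.symm i), a.σ * b.σ⟩ := rfl

theorem one_def : (1 : CubeSym m) = ⟨0, 1, 1⟩ := rfl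

theorem inv_def (a : CubeSym m) :
    a⁻¹ = ⟨fun i => -(a.ε (a.σ i) * a.v (a.σ i)), fun i => a.ε (a.σ i), a.σ.symm⟩ := rfl

theorem symm_mul_apply (σ τ : Equiv.Perm (Fin m)) (i : Fin m) :
    (σ * τ).symm i = τ.symm (σ.symm i) := rfl

theorem symm_one_apply (i : Fin m) : (1 : Equiv.Perm (Fin m)).symm i = i := rfl

instance : Group (CubeSym m) :=
  Group.ofLeftAxioms
    (fun a b c => by
      simp only [mul_def, CubeSym.mk.injEq, symm_mul_apply, Units.val_mul, mul_assoc, and_true]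
      ext i
      ring)
    (fun a => by simp [mul_def, one_def, symm_one_apply])
    (fun a => by
      simp only [mul_def, inv_def, one_def, CubeSym.mk.injEq, Equiv.symm_symm]
      refine ⟨?_, ?_, ?_⟩ <;> ext i <;> simp)

/-- The action on doubled coordinates. -/
instance : MulAction (CubeSym m) (Fin m → ℤ) where
  smul a z := fun i => 2 * a.v i + a.ε i * z (a.σ.symm i)
  one_smul z := by
    ext i
    change 2 * (0 : ℤ) + 1 * z i = z i
    ring
  mul_smul a b z := by
    ext i
    change 2 * (a.v i + a.ε i * b.v (a.σ.symm i)) +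
      (a.ε i * b.ε (a.σ.symm i) : ℤˣ) * z (b.σ.symm (a.σ.symm i)) =
      2 * a.v i + a.ε i * (2 * b.v (a.σ.symm i) + b.ε (a.σ.symm i) * z (b.σ.symm (a.σ.symm i)))
    rw [Units.val_mul]
    ring

theorem smul_apply (a : CubeSym m) (z : Fin m → ℤ) (i : Fin m) :
    (a • z) i = 2 * a.v i + a.ε i * z (a.σ.symm i) := rfl

/-- The translation by `v`. -/
def trans (v : Fin m → ℤ) : CubeSym m := ⟨v, 1, 1⟩

theorem trans_smul_apply (v z : Fin m → ℤ) (i : Fin m) : (trans v • z) i = 2 * v i + z i := by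
  simp [smul_apply, trans, symm_one_apply]

theorem trans_add (v w : Fin m → ℤ) : trans (v + w) = trans v * trans w := by
  ext i <;> simp [trans, mul_def, symm_one_apply]

/-- The translations as a homomorphism. -/
def transHom (m : ℕ) : Multiplicative (Fin m → ℤ) →* CubeSym m where
  toFun v := trans v.toAdd
  map_one' := rfl
  map_mul' v w := trans_add v.toAdd w.toAdd

theorem trans_mem_of_single_mem {H : Subgroup (CubeSym m)}
    (hH : ∀ i, trans (Pi.single i 1) ∈ H) (v : Fin m → ℤ) : trans v ∈ H := by
  induction v using Pi.single_induction with
  | zero => exact one_mem H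
  | add v w hv hw => exact trans_add v w ▸ mul_mem hv hw
  | single i k =>
    have hpow : trans (Pi.single i k) = trans (Pi.single i (1 : ℤ)) ^ k := by
      have h := map_zpow (transHom m) (Multiplicative.ofAdd (Pi.single i 1)) k
      rw [← ofAdd_zsmul, ← Pi.single_smul, smul_eq_mul, mul_one] at h
      exact h
    exact hpow ▸ zpow_mem (hH i) k

/-- The doubled center of the base face of rank `j`. -/
def baseCenter (j : Fin (m + 1)) : Fin m → ℤ := fun i => if (i : ℕ) < j then 0 else -1

theorem even_smul_baseCenter_iff (a : CubeSym m) (j : Fin (m + 1)) (i : Fin m) :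
    2 ∣ (a • baseCenter j) i ↔ (a.σ.symm i : ℕ) < j := by
  rw [smul_apply, baseCenter]
  rcases Int.units_eq_one_or (a.ε i) with hε | hε <;> rw [hε] <;> split_ifs with h <;> simp [h]

theorem lt_iff_of_smul_baseCenter {j : Fin (m + 1)} {a : CubeSym m}
    (ha : a • baseCenter j = baseCenter j) (i : Fin m) :
    (i : ℕ) < j ↔ (a.σ.symm i : ℕ) < j := by
  have h := even_smul_baseCenter_iff 1 j i
  rw [one_smul, ← ha] at h
  exact h.symm.trans (even_smul_baseCenter_iff a j i)

theorem eq_of_smul_baseCenter {j : Fin (m + 1)} {a : CubeSym m}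
    (ha : a • baseCenter j = baseCenter j) :
    a = ⟨fun i => if (i : ℕ) < j then 0 else if a.ε i = 1 then 0 else -1, a.ε, a.σ⟩ := by
  refine CubeSym.ext (funext fun i => ?_) rfl rfl
  change a.v i = if (i : ℕ) < j then 0 else if a.ε i = 1 then 0 else -1
  have h := congrFun ha i
  simp only [smul_apply, baseCenter, ← lt_iff_of_smul_baseCenter ha i] at h
  rcases Int.units_eq_one_or (a.ε i) with hε | hε <;> rw [hε] at h ⊢ <;> split_ifs at h ⊢ <;>
    simp_all
  omega

/-- The four reflections generating the symmetry group. -/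
def gen : Fin 4 → CubeSym 3 :=
  ![⟨0, ![-1, 1, 1], 1⟩, ⟨0, 1, Equiv.swap 0 1⟩, ⟨0, 1, Equiv.swap 1 2⟩,
    ⟨![0, 0, -1], ![1, 1, -1], 1⟩]

theorem gen_smul_baseCenter : ∀ i j : Fin 4, i ≠ j → gen i • baseCenter j = baseCenter j := by
  decide +kernel

/-- A word for the reflection of the coordinate `i` that fixes the base face of rank `j`. -/
def flipWord (j : Fin 4) (i : Fin 3) : List (Fin 4) :=
  if (i : ℕ) < j then ![[0], [1, 0, 1], [2, 1, 0, 1, 2]] i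
  else ![[1, 2, 3, 2, 1], [2, 3, 2], [3]] i

/-- A word for the product of the reflections `flipWord j i` of the coordinates `i` with negative
sign. -/
def signWord (j : Fin 4) (ε : Fin 3 → ℤˣ) : List (Fin 4) :=
  (List.finRange 3).flatMap fun i => if ε i = 1 then [] else flipWord j i

theorem ne_of_mem_signWord : ∀ (j : Fin 4) (ε : Fin 3 → ℤˣ), ∀ x ∈ signWord j ε, x ≠ j := by
  decide +kernel

theorem exists_permWord : ∀ (j : Fin 4) (ε : Fin 3 → ℤˣ) (σ : Equiv.Perm (Fin 3)),
    (∀ i : Fin 3, (i : ℕ) < j ↔ ((σ.symm i : Fin 3) : ℕ) < j) →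
    ∃ w ∈ [[], [1], [2], [1, 2], [2, 1], [1, 2, 1]], (∀ x ∈ w, x ≠ j) ∧
      ((signWord j ε ++ w).map gen).prod =
        ⟨fun i => if (i : ℕ) < j then 0 else if ε i = 1 then 0 else -1, ε, σ⟩ := by
  decide +kernel

theorem closure_gen_image_ne (j : Fin 4) : Subgroup.closure (gen '' {i | i ≠ j}) =
    MulAction.stabilizer (CubeSym 3) (baseCenter j : Fin 3 → ℤ) := by
  refine le_antisymm ((Subgroup.closure_le _).2 ?_) fun a ha => ?_
  · rintro _ ⟨i, hi, rfl⟩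
    exact gen_smul_baseCenter i j hi
  · obtain ⟨w, -, hw, hprod⟩ := exists_permWord j a.ε a.σ (lt_iff_of_smul_baseCenter ha)
    rw [eq_of_smul_baseCenter ha, ← hprod]
    refine list_prod_mem fun x hx => ?_
    obtain ⟨i, hi, rfl⟩ := List.mem_map.1 hx
    exact mem_closure_image_of_mem
      ((List.mem_append.1 hi).elim (ne_of_mem_signWord j a.ε i) (hw i))

theorem prod_flipWord : ∀ i : Fin 3,
    ((flipWord 3 i ++ flipWord 0 i).map gen).prod = trans (Pi.single i 1) := by
  decide +kernel

theorem trans_mem_closure_range_gen (v : Fin 3 → ℤ) :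
    trans v ∈ Subgroup.closure (Set.range gen) := by
  refine trans_mem_of_single_mem (fun i => ?_) v
  rw [← prod_flipWord i]
  refine list_prod_mem fun x hx => ?_
  obtain ⟨k, -, rfl⟩ := List.mem_map.1 hx
  exact Subgroup.subset_closure (Set.mem_range_self k)

theorem closure_range_gen : Subgroup.closure (Set.range gen) = ⊤ := by
  refine eq_top_iff.2 fun a _ => ?_
  obtain ⟨v, hv⟩ : ∃ v : Fin 3 → ℤ, a • baseCenter 0 = trans v • (baseCenter 0 : Fin 3 → ℤ) := by
    refine ⟨fun i => a.v i + if a.ε i = 1 then 0 else 1, ?_⟩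
    ext i
    rw [trans_smul_apply, smul_apply]
    rcases Int.units_eq_one_or (a.ε i) with hε | hε <;> simp [baseCenter, hε]
    ring
  have hstab : (trans v)⁻¹ * a ∈ MulAction.stabilizer _ (baseCenter 0 : Fin 3 → ℤ) := by
    rw [MulAction.mem_stabilizer_iff, mul_smul, hv, inv_smul_smul]
  rw [← closure_gen_image_ne] at hstab
  rw [← mul_inv_cancel_left (trans v) a]
  exact mul_mem (trans_mem_closure_range_gen v)
    (Subgroup.closure_mono (Set.image_subset_range _ _) hstab)

end CubeSym

namespace CubeCell

open CubeSym

variable {m : ℕ}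

/-- The doubled center of a cell, with respect to the point with all coordinates `1/2`. -/
def center (C : CubeCell m) : Fin m → ℤ :=
  fun i => 2 * C.base i + (if i ∈ C.dirs then 1 else 0) - 1

/-- The cell with a given doubled center. -/
def ofCenter (z : Fin m → ℤ) : CubeCell m :=
  ⟨fun i => (z i + 1) / 2, Finset.univ.filter fun i => 2 ∣ z i⟩

theorem mem_dirs_iff {C : CubeCell m} {i : Fin m} : i ∈ C.dirs ↔ 2 ∣ C.center i := by
  rw [center]
  split_ifs with h <;> simp only [h, true_iff, false_iff] <;> omega

theorem center_ofCenter (z : Fin m → ℤ) : (ofCenter z).center = z := by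
  ext i
  simp only [center, ofCenter, Finset.mem_filter, Finset.mem_univ, true_and]
  split_ifs <;> omega

theorem ofCenter_center (C : CubeCell m) : ofCenter C.center = C := by
  ext i
  · simp only [ofCenter, center]
    split_ifs <;> omega
  · simp [ofCenter, mem_dirs_iff]

theorem center_eq_trans_smul_iff {C E : CubeCell m} {v : Fin m → ℤ} :
    E.center = trans v • C.center ↔ C.dirs = E.dirs ∧ E.base - C.base = v := by
  constructor
  · intro h
    have hdirs : C.dirs = E.dirs := by
      ext i
      rw [mem_dirs_iff, mem_dirs_iff, h, trans_smul_apply]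
      exact (Int.dvd_add_right (dvd_mul_right _ _)).symm
    refine ⟨hdirs, funext fun i => ?_⟩
    have := congrFun h i
    rw [trans_smul_apply, center, center, hdirs] at this
    rw [Pi.sub_apply]
    omega
  · rintro ⟨hdirs, rfl⟩
    ext i
    rw [trans_smul_apply, center, center, hdirs, Pi.sub_apply]
    ring

theorem le_iff_center {C E : CubeCell m} : C ≤ E ↔ ∀ i, C.center i = E.center i ∨
    (2 ∣ E.center i ∧ (C.center i = E.center i + 1 ∨ C.center i = E.center i - 1)) := by
  have h : C ≤ E ↔ ∀ i, E.base i ≤ C.base i ∧ C.corner i ≤ E.corner i :=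
    forall_and.symm
  refine h.trans (forall_congr' fun i => ?_)
  rw [← mem_dirs_iff, corner, corner, center, center]
  split_ifs with hC hE hE <;> simp only [hE, true_and, false_and, or_false] <;> omega

theorem dirs_subset_of_le {C E : CubeCell m} (h : C ≤ E) : C.dirs ⊆ E.dirs := by
  intro i
  have := le_iff_center.1 h i
  rw [mem_dirs_iff, mem_dirs_iff]
  omega

/-- The image under `a` of the base face of rank `j`. -/
def image (a : CubeSym m) (j : Fin (m + 1)) : CubeCell m := ofCenter (a • baseCenter j)

theorem image_eq_iff {a : CubeSym m} {j : Fin (m + 1)} {C : CubeCell m} :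
    image a j = C ↔ a • baseCenter j = C.center :=
  ⟨fun h => h ▸ (center_ofCenter _).symm, fun h => by rw [image, h, ofCenter_center]⟩

theorem card_dirs_image (a : CubeSym m) (j : Fin (m + 1)) : (image a j).dirs.card = j := by
  have hmap : (image a j).dirs =
      (Finset.univ.filter fun i : Fin m => (i : ℕ) < j).map a.σ.toEmbedding := by
    ext i
    rw [mem_dirs_iff, image, center_ofCenter, even_smul_baseCenter_iff, Finset.mem_map_equiv]
    simp
  rw [hmap, Finset.card_map, Fin.card_filter_val_lt, min_eq_right (Nat.le_of_lt_succ j.2)]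

theorem image_le_image (a : CubeSym m) {j k : Fin (m + 1)} (hjk : j ≤ k) :
    image a j ≤ image a k := by
  refine le_iff_center.2 fun i => ?_
  simp only [image, center_ofCenter, smul_apply, baseCenter]
  have : (j : ℕ) ≤ k := hjk
  rcases Int.units_eq_one_or (a.ε i) with hε | hε <;> rw [hε] <;> split_ifs <;> simp <;> omega

theorem exists_perm_of_subset : ∀ X Y : Finset (Fin 3), X ⊆ Y → ∃ σ : Equiv.Perm (Fin 3),
    (∀ i, i ∈ X ↔ (σ.symm i : ℕ) < X.card) ∧ ∀ i, i ∈ Y ↔ (σ.symm i : ℕ) < Y.card := by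
  decide +kernel

theorem exists_image_of_le {C E : CubeCell 3} (h : C ≤ E) :
    ∃ a j k, j ≤ k ∧ image a j = C ∧ image a k = E := by
  obtain ⟨σ, hC, hE⟩ := exists_perm_of_subset _ _ (dirs_subset_of_le h)
  have hcard : ∀ X : Finset (Fin 3), X.card < 4 := fun X => by
    simpa [Nat.lt_succ_iff] using X.card_le_univ
  refine ⟨⟨fun i => if i ∈ E.dirs then E.center i / 2 else (E.center i + 1) / 2,
    fun i => if C.center i = E.center i + 1 then -1 else 1, σ⟩, ⟨_, hcard C.dirs⟩,
    ⟨_, hcard E.dirs⟩, Finset.card_le_card (dirs_subset_of_le h), ?_, ?_⟩ <;>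
  · refine image_eq_iff.2 (funext fun i => ?_)
    have := le_iff_center.1 h i
    simp only [smul_apply, baseCenter, ← hC, ← hE, mem_dirs_iff]
    split_ifs <;> simp <;> omega

/-- The class in the toroid of type `q` of the image under `a` of the base face of rank `j`. -/
def imageClass (q : Fin m → ℤ) (a : CubeSym m) (j : Fin (m + 1)) : ToroidCell q :=
  Quotient.mk (cellSetoid q) (image a j)

variable {q : Fin m → ℤ}

theorem imageClass_eq_iff {a b : CubeSym m} {j k : Fin (m + 1)} :
    imageClass q a j = imageClass q b k ↔
      j = k ∧ ∃ v ∈ typeLattice q, b • baseCenter k = trans v • a • baseCenter j := by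
  have hrel : imageClass q a j = imageClass q b k ↔
      ∃ v ∈ typeLattice q, (image b k).center = trans v • (image a j).center := by
    refine (Quotient.eq (r := cellSetoid q)).trans ?_
    simp only [center_eq_trans_smul_iff]
    exact ⟨fun h => ⟨_, h.2, h.1, rfl⟩, fun ⟨_, hv, hdirs, hbase⟩ => ⟨hdirs, hbase ▸ hv⟩⟩
  rw [hrel]
  refine ⟨fun ⟨v, hv, h⟩ => ⟨Fin.ext ?_, v, hv, ?_⟩, fun ⟨_, v, hv, h⟩ => ⟨v, hv, ?_⟩⟩
  · rw [← card_dirs_image a j, ← card_dirs_image b k, (center_eq_trans_smul_iff.1 h).1]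
  · simpa only [image, center_ofCenter] using h
  · simpa only [image, center_ofCenter] using h

theorem imageClass_le_imageClass (a : CubeSym m) {j k : Fin (m + 1)} (hjk : j ≤ k) :
    imageClass q a j ≤ imageClass q a k :=
  ⟨_, _, rfl, rfl, image_le_image a hjk⟩

theorem exists_imageClass_of_le {q : Fin 3 → ℤ} {x y : ToroidCell q} (h : x ≤ y) :
    ∃ a j k, j ≤ k ∧ imageClass q a j = x ∧ imageClass q a k = y := by
  obtain ⟨C, E, rfl, rfl, hCE⟩ := h
  obtain ⟨a, j, k, hjk, rfl, rfl⟩ := exists_image_of_le hCE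
  exact ⟨a, j, k, hjk, rfl, rfl⟩

theorem exists_imageClass_eq {q : Fin 3 → ℤ} (x : ToroidCell q) : ∃ a j, imageClass q a j = x := by
  obtain ⟨C, rfl⟩ := Quotient.exists_rep x
  obtain ⟨a, j, -, -, h, -⟩ := exists_image_of_le (C := C) (E := C) ⟨le_rfl, le_rfl⟩
  exact ⟨a, j, congrArg _ h⟩

end CubeCell

/-! ### Facets isomorphic to cubic toroids -/

theorem exists_orderEmbedding_of_surjective {A X P : Type*} [LE X] [LE P] {f : A → X} {g : A → P}
    (hf : Function.Surjective f) (heq : ∀ a b, f a = f b ↔ g a = g b)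
    (hle : ∀ a b, f a ≤ f b ↔ g a ≤ g b) : ∃ e : X ↪o P, ∀ a, e (f a) = g a := by
  have hs := Function.surjInv_eq hf
  refine ⟨⟨⟨fun x => g (Function.surjInv hf x), fun x y h => ?_⟩, fun {x y} => ?_⟩,
    fun a => (heq _ _).1 (hs (f a))⟩
  · rw [← hs x, ← hs y]
    exact (heq _ _).2 h
  · change g _ ≤ g _ ↔ x ≤ y
    rw [← hle, hs, hs]

theorem nonempty_withBot_withTop_orderIso {X P : Type*} [LE X] [LE P] {b t : P} (hbt : b ≠ t)
    (hb : ∀ p, b ≤ p) (ht : ∀ p, p ≤ t) (hb' : ∀ p, p ≤ b → p = b) (ht' : ∀ p, t ≤ p → p = t)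
    (e : X ↪o P) (he : Set.range e = {b, t}ᶜ) : Nonempty (WithBot (WithTop X) ≃o P) := by
  have hne : ∀ x, e x ≠ b ∧ e x ≠ t := fun x => by
    have hx : e x ∈ ({b, t}ᶜ : Set P) := he ▸ Set.mem_range_self x
    simpa using hx
  let f : WithBot (WithTop X) → P := WithBot.recBotCoe b (WithTop.recTopCoe t e)
  have hinj : Function.Injective f := by
    simp [Function.Injective, WithBot.forall, WithTop.forall, f, hne, hbt, hbt.symm, (hne _).1.symm,
      (hne _).2.symm]
  have hle : ∀ x y, f x ≤ f y ↔ x ≤ y := by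
    have hmono : ∀ x y, e x ≤ e y ↔ x ≤ y := fun _ _ => e.map_rel_iff
    have hnle : ¬ t ≤ b := fun h => hbt (ht' b h)
    have hxb : ∀ x, ¬ e x ≤ b := fun x h => (hne x).1 (hb' _ h)
    have htx : ∀ x, ¬ t ≤ e x := fun x h => (hne x).2 (ht' _ h)
    simp [WithBot.forall, WithTop.forall, f, hb, ht, hnle, hxb, htx, hmono]
  have hsurj : Function.Surjective f := by
    intro p
    by_cases hp : p ∈ Set.range e
    · obtain ⟨x, rfl⟩ := hp
      exact ⟨((x : WithTop X) : WithBot (WithTop X)), rfl⟩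
    · rw [he, Set.mem_compl_iff, not_not] at hp
      rcases hp with rfl | rfl
      exacts [⟨⊥, rfl⟩, ⟨((⊤ : WithTop X) : WithBot (WithTop X)), rfl⟩]
  exact ⟨⟨Equiv.ofBijective f ⟨hinj, hsurj⟩, fun {x y} => hle x y⟩⟩

section Facet

open CosetFace CubeSym CubeCell

variable {Γ : Type*} [Group Γ] {ρ : Fin 5 → Γ} {q : Fin 3 → ℤ} {φ : CubeSym 3 →* Γ}

/-- The index in the coset geometry of a group with five generators of a face of rank `j ≤ 3`. -/
def rankIdx (j : Fin 4) : Fin 7 := ⟨j + 1, by omega⟩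

theorem rankIdx_injective : Function.Injective rankIdx := by decide

theorem rankIdx_lt_five : ∀ j, rankIdx j < 5 := by decide

theorem exists_rankIdx : ∀ i : Fin 7, i ≤ 5 → i ≠ 0 → i ≠ 5 → ∃ j, rankIdx j = i := by
  decide

theorem faceSubgroup_five_eq_range (hφ : ∀ i, φ (gen i) = ρ i.castSucc) :
    faceSubgroup ρ 5 = φ.range := by
  have hcastSucc : {i : Fin 5 | (i : ℕ) + 1 ≠ (5 : Fin 7)} = Fin.castSucc '' Set.univ := by
    ext i
    simp only [Set.mem_ofPred_eq, Set.image_univ, Set.mem_range]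
    revert i
    decide
  rw [faceSubgroup, hcastSucc, ← map_closure_image hφ, Set.image_univ, closure_range_gen,
    MonoidHom.range_eq_map]

theorem mem_of_one_five_iff (hφ : ∀ i, φ (gen i) = ρ i.castSucc) {g : Γ} :
    g ∈ of ρ 1 5 ↔ ∃ a, φ a = g := by
  rw [mem_of_iff, inv_one, one_mul, faceSubgroup_five_eq_range hφ, MonoidHom.mem_range]

theorem of_map_le_of_one_five (hφ : ∀ i, φ (gen i) = ρ i.castSucc) (a : CubeSym 3) (j : Fin 4) :
    of ρ (φ a) (rankIdx j) ≤ of ρ 1 5 :=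
  le_of_mem (mem_of _ _) ((mem_of_one_five_iff hφ).2 ⟨a, rfl⟩) (rankIdx_lt_five j).le

theorem map_mem_faceSubgroup_rankIdx_iff (hρ : IsStringCGroup ρ)
    (hφ : ∀ i, φ (gen i) = ρ i.castSucc) {j : Fin 4} {a : CubeSym 3} :
    φ a ∈ faceSubgroup ρ (rankIdx j) ↔
      φ a ∈ (MulAction.stabilizer (CubeSym 3) (baseCenter j : Fin 3 → ℤ)).map φ := by
  have hinf : faceSubgroup ρ 5 ⊓ faceSubgroup ρ (rankIdx j) =
      (MulAction.stabilizer (CubeSym 3) (baseCenter j : Fin 3 → ℤ)).map φ := by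
    have hcastSucc : {i : Fin 5 | (i : ℕ) + 1 ≠ (5 : Fin 7)} ∩ {i | (i : ℕ) + 1 ≠ rankIdx j} =
        Fin.castSucc '' {i : Fin 4 | i ≠ j} := by
      ext i
      simp only [Set.mem_inter_iff, Set.mem_ofPred_eq, Set.mem_image, rankIdx]
      revert i j
      decide
    rw [faceSubgroup, faceSubgroup, hρ.intersection, hcastSucc, ← map_closure_image hφ,
      closure_gen_image_ne]
  rw [← hinf, Subgroup.mem_inf, faceSubgroup_five_eq_range hφ, and_iff_right ⟨a, rfl⟩]

theorem imageClass_eq_iff_of_map (hρ : IsStringCGroup ρ) (hφ : ∀ i, φ (gen i) = ρ i.castSucc)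
    (hker : ∀ a, φ a = 1 ↔ ∃ v ∈ typeLattice q, a = trans v) {a b : CubeSym 3} {j k : Fin 4} :
    imageClass q a j = imageClass q b k ↔
      of ρ (φ a) (rankIdx j) = of ρ (φ b) (rankIdx k) := by
  suffices h : (∃ v ∈ typeLattice q, b • (baseCenter j : Fin 3 → ℤ) = trans v • a • baseCenter j) ↔
      of ρ (φ a) (rankIdx j) = of ρ (φ b) (rankIdx j) by
    rw [imageClass_eq_iff]
    constructor
    · rintro ⟨rfl, hv⟩
      exact h.1 hv
    · intro hof
      obtain rfl : j = k := rankIdx_injective (congrArg CosetFace.idx hof)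
      exact ⟨rfl, h.2 hof⟩
  rw [of_eq_of_iff, mem_of_iff, ← map_inv, ← map_mul, map_mem_faceSubgroup_rankIdx_iff hρ hφ]
  constructor
  · rintro ⟨v, hv, hbv⟩
    have hstab : a⁻¹ * (CubeSym.trans v)⁻¹ * b ∈
        MulAction.stabilizer _ (baseCenter j : Fin 3 → ℤ) := by
      rw [MulAction.mem_stabilizer_iff, mul_smul, mul_smul, hbv, inv_smul_smul, inv_smul_smul]
    refine ⟨_, hstab, ?_⟩
    rw [map_mul, map_mul, map_mul, map_inv φ (CubeSym.trans v), (hker _).2 ⟨v, hv, rfl⟩, inv_one,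
      mul_one]
  · rintro ⟨y, hy, hyab⟩
    have hone : φ (b * (a * y)⁻¹) = 1 := by
      rw [map_mul, map_inv, map_mul, hyab, map_mul, map_inv, mul_inv_cancel_left, mul_inv_cancel]
    obtain ⟨v, hv, htrans⟩ := (hker _).1 hone
    refine ⟨v, hv, ?_⟩
    rw [mul_inv_eq_iff_eq_mul.1 htrans, mul_smul, mul_smul, MulAction.mem_stabilizer_iff.1 hy]

theorem imageClass_le_iff_of_map (hρ : IsStringCGroup ρ) (hφ : ∀ i, φ (gen i) = ρ i.castSucc)
    (hker : ∀ a, φ a = 1 ↔ ∃ v ∈ typeLattice q, a = trans v) {a b : CubeSym 3} {j k : Fin 4} :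
    imageClass q a j ≤ imageClass q b k ↔
      of ρ (φ a) (rankIdx j) ≤ of ρ (φ b) (rankIdx k) := by
  constructor
  · intro h
    obtain ⟨c, j', k', hjk, hj, hk⟩ := exists_imageClass_of_le h
    rw [imageClass_eq_iff_of_map hρ hφ hker] at hj hk
    rw [← hj, ← hk]
    exact of_le_of (Nat.succ_le_succ hjk)
  · intro h
    obtain ⟨g, hga, hgb, hg⟩ := exists_mem_of_le_of_le hρ.commute h
      (of_map_le_of_one_five hφ b k)
    obtain ⟨c, rfl⟩ := (mem_of_one_five_iff hφ).1 hg
    rw [(imageClass_eq_iff_of_map hρ hφ hker).2 (of_eq_of_iff.2 hga),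
      (imageClass_eq_iff_of_map hρ hφ hker).2 (of_eq_of_iff.2 hgb)]
    exact imageClass_le_imageClass c (Nat.succ_le_succ_iff.1 h.1)

theorem mem_range_of_map_iff (hφ : ∀ i, φ (gen i) = ρ i.castSucc) {H : CosetFace ρ}
    (hH : H ≤ of ρ 1 5) :
    (∃ a j, of ρ (φ a) (rankIdx j) = H) ↔ H.idx ≠ 0 ∧ H ≠ of ρ 1 5 := by
  constructor
  · rintro ⟨a, j, rfl⟩
    exact ⟨fun h => Nat.succ_ne_zero j (congrArg Fin.val h),
      fun h => (rankIdx_lt_five j).ne (congrArg CosetFace.idx h)⟩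
  · rintro ⟨h0, h5⟩
    obtain ⟨-, g, hg, hg5⟩ := le_iff.1 hH
    obtain ⟨a, rfl⟩ := (mem_of_one_five_iff hφ).1 hg5
    obtain ⟨j, hj⟩ := exists_rankIdx H.idx hH.1 h0 (idx_lt hH h5).ne
    exact ⟨a, j, hj ▸ mem_iff_of_eq.1 hg⟩

-- The cells of the toroid and the proper faces of the base facet are both parametrized by a
-- symmetry of the tessellation and a rank.
theorem IsStringCGroup.nonempty_baseFacet_iso (hρ : IsStringCGroup ρ)
    (hφ : ∀ i, φ (gen i) = ρ i.castSucc)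
    (hker : ∀ a, φ a = 1 ↔ ∃ v ∈ typeLattice q, a = trans v) :
    Nonempty (CubicToroid q ≃o {H : CosetFace ρ // H ≤ of ρ 1 5}) := by
  let face : CubeSym 3 × Fin 4 → {H : CosetFace ρ // H ≤ of ρ 1 5} := fun x =>
    ⟨of ρ (φ x.1) (rankIdx x.2), of_map_le_of_one_five hφ x.1 x.2⟩
  have hsurj : Function.Surjective fun x : CubeSym 3 × Fin 4 => imageClass q x.1 x.2 := fun x =>
    let ⟨a, j, h⟩ := exists_imageClass_eq x
    ⟨(a, j), h⟩
  obtain ⟨e, he⟩ := exists_orderEmbedding_of_surjective (g := face) hsurj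
    (fun x y => (imageClass_eq_iff_of_map hρ hφ hker).trans
      (Subtype.coe_inj (a := face x) (b := face y)))
    (fun _ _ => imageClass_le_iff_of_map hρ hφ hker)
  refine nonempty_withBot_withTop_orderIso (b := ⟨of ρ 1 0, of_le_of (Fin.zero_le _)⟩)
    (t := ⟨of ρ 1 5, refl _⟩) ?_ ?_ (fun H => H.2) ?_ ?_ e ?_
  · exact fun h => absurd (congrArg (fun H => H.1.idx) h) (show (0 : Fin 7) ≠ 5 by decide)
  · intro H
    obtain ⟨g, hg⟩ := H.1.exists_mem
    exact le_of_mem (hρ.mem_of_idx_eq_zero rfl g) hg (Fin.zero_le _)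
  · exact fun H h => Subtype.ext (eq_of_le_of_idx_eq h (le_antisymm h.1 (Fin.zero_le _)))
  · exact fun H h => Subtype.ext (CosetFace.le_antisymm H.2 h)
  · ext H
    have hrange : H ∈ Set.range e ↔ ∃ a j, of ρ (φ a) (rankIdx j) = H.1 := by
      simp only [Set.mem_range, hsurj.exists, he, Prod.exists, face, Subtype.ext_iff]
    have hbot : H.1.idx = 0 ↔ H.1 = of ρ 1 0 :=
      ⟨fun h => eq_of_mem (hρ.mem_of_idx_eq_zero h 1) (mem_of 1 0) h, fun h => h ▸ rfl⟩
    rw [hrange, mem_range_of_map_iff hφ H.2, Ne, hbot]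
    simp only [Set.mem_compl_iff, Set.mem_insert_iff, Set.mem_singleton_iff, not_or,
      Subtype.ext_iff, ne_eq]

theorem IsStringCGroup.nonempty_facet_iso (hρ : IsStringCGroup ρ)
    (hφ : ∀ i, φ (gen i) = ρ i.castSucc)
    (hker : ∀ a, φ a = 1 ↔ ∃ v ∈ typeLattice q, a = trans v) {F : CosetFace ρ} (hF : F.rk = 4) :
    Nonempty ({H // H ≤ F} ≃o CubicToroid q) := by
  have hF5 : F.idx = 5 := by
    rw [CosetFace.rk] at hF
    exact Fin.ext (show (F.idx : ℕ) = 5 by omega)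
  obtain ⟨e⟩ := F.nonempty_lower_iso
  obtain ⟨e'⟩ := hρ.nonempty_baseFacet_iso hφ hker
  rw [hF5] at e
  exact ⟨e.trans e'.symm⟩

end Facet

/-! ### The linear representation of the symmetries -/

namespace CubeSym

variable {m : ℕ}

/-- The linear extension of the affine action of `a`: it induces this action on the points `-x / β`
and preserves the form `α β - ∑ k, (x k ^ 2 - β * x k)` on the triples `(α, x, β)`. -/
def lin (a : CubeSym m) (p : ℤ × (Fin m → ℤ) × ℤ) : ℤ × (Fin m → ℤ) × ℤ :=
  (p.1 - ∑ k, (2 * a.v k * a.ε k + a.ε k - 1) * p.2.1 (a.σ.symm k) +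
      p.2.2 * ∑ k, (a.v k ^ 2 + a.v k),
    fun k => a.ε k * p.2.1 (a.σ.symm k) - p.2.2 * a.v k, p.2.2)

theorem lin_one (p : ℤ × (Fin m → ℤ) × ℤ) : lin 1 p = p := by
  simp [lin, one_def, symm_one_apply]

theorem lin_mul (a b : CubeSym m) (p : ℤ × (Fin m → ℤ) × ℤ) : lin (a * b) p = lin a (lin b p) := by
  obtain ⟨α, x, β⟩ := p
  simp only [lin, mul_def, symm_mul_apply, Units.val_mul, Prod.mk.injEq, and_true]
  refine ⟨?_, funext fun k => by ring⟩
  rw [← Equiv.sum_comp a.σ.symm fun k => (2 * b.v k * b.ε k + b.ε k - 1) * x (b.σ.symm k),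
    ← Equiv.sum_comp a.σ.symm fun k => b.v k ^ 2 + b.v k]
  simp only [Finset.mul_sum, ← Finset.sum_add_distrib, sub_eq_add_neg,
    ← Finset.sum_neg_distrib, add_assoc, add_right_inj]
  refine Finset.sum_congr rfl fun k _ => ?_
  rcases Int.units_eq_one_or (a.ε k) with hε | hε <;> rw [hε] <;> push_cast <;> ring

theorem lin_trans_sub (v : Fin m → ℤ) (p : ℤ × (Fin m → ℤ) × ℤ) : (trans v).lin p - p =
    (p.2.2 * ∑ k, (v k ^ 2 + v k) - 2 * ∑ k, v k * p.2.1 k, -(p.2.2 • v), 0) := by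
  ext
  · simp [lin, trans, symm_one_apply, Finset.mul_sum, mul_assoc]
    ring
  · simp [lin, trans, symm_one_apply]
  · simp [lin]

theorem lin_trans_smul_sub (d : ℤ) (c : Fin m → ℤ) (p : ℤ × (Fin m → ℤ) × ℤ) :
    (trans (d • c)).lin p - p =
      d • (p.2.2 * ∑ k, (d * c k ^ 2 + c k) - 2 * ∑ k, c k * p.2.1 k, -(p.2.2 • c), 0) := by
  rw [lin_trans_sub]
  ext
  · simp only [Pi.smul_apply, smul_eq_mul, Prod.smul_fst, mul_sub, Finset.mul_sum]
    congr 1 <;> exact Finset.sum_congr rfl fun k _ => by ring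
  · simp only [Prod.smul_snd, Prod.smul_fst, Pi.neg_apply, Pi.smul_apply, smul_eq_mul]
    ring
  · simp

theorem gen_mul_self (i : Fin 4) : gen i * gen i = 1 := by
  revert i
  decide +kernel

end CubeSym

namespace BasicSystem

open Matrix CubeSym modGroup

/-- The factor of the first basis vector in the embedding of the root lattice. -/
def headScale : BasicSystem → ℤ
  | .a => 1
  | .b => 1
  | .c => 2
  | .d => 2

/-- The factor of the last two basis vectors in the embedding of the root lattice. -/
def tailScale : BasicSystem → ℤ
  | .a => 2
  | .b => 1
  | .c => 2
  | .d => 1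

/-- The embedding of the root lattice into `ℤ ⊕ ℤ³ ⊕ ℤ` under which the first four reflections
become the generators of the symmetry group of the cubical tessellation. -/
def embed (D : BasicSystem) : (Fin 5 → ℤ) →ₗ[ℤ] ℤ × (Fin 3 → ℤ) × ℤ where
  toFun y := (D.headScale * y 0,
    ![y 1 - D.headScale * y 0, y 2 - y 1, D.tailScale * y 3 - y 2], D.tailScale * y 4)
  map_add' y z := by
    ext k
    · simp [mul_add]
    · fin_cases k <;> simp <;> ring
    · simp [mul_add]
  map_smul' c y := by
    ext k
    · simp [mul_left_comm]
    · fin_cases k <;> simp <;> ring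
    · simp [mul_left_comm]

variable (D : BasicSystem)

theorem headScale_ne_zero : D.headScale ≠ 0 := by cases D <;> decide

theorem tailScale_ne_zero : D.tailScale ≠ 0 := by cases D <;> decide

theorem headScale_dvd_two : D.headScale ∣ 2 := by cases D <;> decide

theorem tailScale_dvd_two : D.tailScale ∣ 2 := by cases D <;> decide

theorem embed_eq_iff {y : Fin 5 → ℤ} {p : ℤ × (Fin 3 → ℤ) × ℤ} : D.embed y = p ↔
    D.headScale * y 0 = p.1 ∧ y 1 - D.headScale * y 0 = p.2.1 0 ∧ y 2 - y 1 = p.2.1 1 ∧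
      D.tailScale * y 3 - y 2 = p.2.1 2 ∧ D.tailScale * y 4 = p.2.2 := by
  obtain ⟨α, x, β⟩ := p
  simp only [embed, LinearMap.coe_mk, AddHom.coe_mk, Prod.mk.injEq, funext_iff,
    Fin.forall_fin_succ]
  simp [and_assoc]

theorem embed_injective : Function.Injective D.embed := by
  refine (injective_iff_map_eq_zero _).2 fun y hy => ?_
  obtain ⟨h0, h1, h2, h3, h4⟩ := D.embed_eq_iff.1 hy
  simp only [Prod.fst_zero, Prod.snd_zero, Pi.zero_apply] at h0 h1 h2 h3 h4
  rw [h0, sub_zero] at h1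
  rw [h1, sub_zero] at h2
  rw [h2, sub_zero] at h3
  ext i
  fin_cases i
  exacts [(mul_eq_zero_iff_left D.headScale_ne_zero).1 h0, h1, h2,
    (mul_eq_zero_iff_left D.tailScale_ne_zero).1 h3,
    (mul_eq_zero_iff_left D.tailScale_ne_zero).1 h4]

theorem exists_embed_eq_iff {p : ℤ × (Fin 3 → ℤ) × ℤ} : (∃ y, D.embed y = p) ↔
    D.headScale ∣ p.1 ∧ D.tailScale ∣ p.1 + ∑ k, p.2.1 k ∧ D.tailScale ∣ p.2.2 := by
  simp only [embed_eq_iff, Fin.sum_univ_three]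
  constructor
  · rintro ⟨y, h0, h1, h2, h3, h4⟩
    exact ⟨⟨y 0, h0.symm⟩, ⟨y 3, by linarith⟩, ⟨y 4, h4.symm⟩⟩
  · rintro ⟨⟨y₀, h0⟩, ⟨y₃, h3⟩, ⟨y₄, h4⟩⟩
    refine ⟨![y₀, p.1 + p.2.1 0, p.1 + p.2.1 0 + p.2.1 1, y₃, y₄], h0.symm, ?_, ?_, ?_, h4.symm⟩
    all_goals simp only [cons_val_zero, cons_val_one, cons_val]; linarith

theorem reflMatrix_mulVec {n : ℕ} (a : Fin n → ℕ) (i : Fin n) (y : Fin n → ℤ) :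
    reflMatrix a i *ᵥ y = fun k => y k + if k = i then ∑ j, cartanInt a i j * y j else 0 := by
  rw [reflMatrix, add_mulVec, one_mulVec, vecMulVec_mulVec]
  ext k
  simp [Pi.single_apply, dotProduct]

theorem embed_reflMatrix (i : Fin 4) (y : Fin 5 → ℤ) :
    D.embed (reflMatrix D.labels i.castSucc *ᵥ y) = (gen i).lin (D.embed y) := by
  rw [reflMatrix_mulVec, embed_eq_iff]
  cases D <;> fin_cases i <;>
    simp [lin, gen, embed, headScale, tailScale, Fin.sum_univ_succ, cartanInt, labels,
      Equiv.swap_apply_def, symm_one_apply] <;> omega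

theorem exists_embed_mulVec_eq_lin (a : CubeSym 3) : ∃ M ∈ linGroup D.labels,
    ∀ y, D.embed (M.val *ᵥ y) = a.lin (D.embed y) := by
  have ha : a ∈ Subgroup.closure (gen '' Set.univ) := by
    rw [Set.image_univ, closure_range_gen]
    trivial
  refine closure_image_induction_left gen_mul_self (p := fun a => ∃ M ∈ linGroup D.labels,
    ∀ y, D.embed (M.val *ᵥ y) = a.lin (D.embed y)) ?_ ?_ ha
  · exact ⟨1, one_mem _, fun y => by rw [Units.val_one, one_mulVec, lin_one]⟩
  · rintro x i - ⟨M, hM, hMy⟩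
    refine ⟨rootReflection D.labels i.castSucc * M,
      mul_mem (Subgroup.subset_closure (Set.mem_range_self _)) hM, fun y => ?_⟩
    rw [Units.val_mul, ← mulVec_mulVec, lin_mul, ← hMy]
    exact D.embed_reflMatrix i _

theorem eq_of_embed_mulVec_eq {M N : GeneralLinearGroup (Fin 5) ℤ}
    (h : ∀ y, D.embed (M.val *ᵥ y) = D.embed (N.val *ᵥ y)) : M = N :=
  Units.ext <| Matrix.toLin'.injective <| LinearMap.ext fun y => D.embed_injective (h y)

/-- The element of the group generated by the first four reflections that corresponds to a symmetry
of the cubical tessellation. -/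
noncomputable def facetMatrix (a : CubeSym 3) : GeneralLinearGroup (Fin 5) ℤ :=
  (D.exists_embed_mulVec_eq_lin a).choose

theorem facetMatrix_mem (a : CubeSym 3) : D.facetMatrix a ∈ linGroup D.labels :=
  (D.exists_embed_mulVec_eq_lin a).choose_spec.1

theorem embed_facetMatrix (a : CubeSym 3) (y : Fin 5 → ℤ) :
    D.embed ((D.facetMatrix a).val *ᵥ y) = a.lin (D.embed y) :=
  (D.exists_embed_mulVec_eq_lin a).choose_spec.2 y

theorem facetMatrix_mul (a b : CubeSym 3) :
    D.facetMatrix (a * b) = D.facetMatrix a * D.facetMatrix b := by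
  refine D.eq_of_embed_mulVec_eq fun y => ?_
  rw [embed_facetMatrix, Units.val_mul, ← mulVec_mulVec, embed_facetMatrix, embed_facetMatrix,
    lin_mul]

theorem facetMatrix_gen (i : Fin 4) :
    D.facetMatrix (gen i) = rootReflection D.labels i.castSucc := by
  refine D.eq_of_embed_mulVec_eq fun y => ?_
  rw [embed_facetMatrix, ← embed_reflMatrix]
  rfl

/-- The homomorphism from the symmetry group of the cubical tessellation onto the group of the
base facet. -/
noncomputable def facetHom (d : ℕ) : CubeSym 3 →* modGroup D.labels d :=
  MonoidHom.mk' (fun a => ⟨reduce 5 d (D.facetMatrix a),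
    Subgroup.mem_map_of_mem _ (D.facetMatrix_mem a)⟩) fun a b => by
      apply Subtype.ext
      rw [Subgroup.coe_mul]
      simp only [facetMatrix_mul, map_mul]

theorem facetHom_gen (d : ℕ) (i : Fin 4) :
    D.facetHom d (gen i) = modGen D.labels d i.castSucc := by
  apply Subtype.ext
  change reduce 5 d (D.facetMatrix (gen i)) = _
  rw [facetMatrix_gen]
  rfl

/-! ### The kernel of the reduction -/

theorem reduce_eq_one_iff {n d : ℕ} (M : GeneralLinearGroup (Fin n) ℤ) :
    reduce n d M = 1 ↔ ∀ y : Fin n → ℤ, ∃ z : Fin n → ℤ, M.val *ᵥ y - y = (d : ℤ) • z := by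
  have hentry : reduce n d M = 1 ↔
      ∀ i j, (d : ℤ) ∣ M.val i j - (1 : Matrix (Fin n) (Fin n) ℤ) i j := by
    rw [← Units.val_inj, ← Matrix.ext_iff]
    refine forall₂_congr fun i j => ?_
    change ((M.val i j : ℤ) : ZMod d) = (1 : Matrix (Fin n) (Fin n) (ZMod d)) i j ↔ _
    rw [← ZMod.intCast_zmod_eq_zero_iff_dvd, Int.cast_sub, sub_eq_zero, one_apply, one_apply]
    push_cast
    rfl
  rw [hentry]
  constructor
  · intro h y
    choose t ht using h
    refine ⟨Matrix.of t *ᵥ y, ?_⟩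
    have hM : M.val - 1 = (d : ℤ) • Matrix.of t := Matrix.ext ht
    rw [← smul_mulVec, ← hM, sub_mulVec, one_mulVec]
  · intro h i j
    obtain ⟨z, hz⟩ := h (Pi.single j 1)
    refine ⟨z i, ?_⟩
    have hcol := congrFun hz i
    rwa [← one_mulVec (Pi.single j 1), mulVec_mulVec, mul_one, ← sub_mulVec,
      mulVec_single_one] at hcol

theorem facetHom_eq_one_iff {d : ℕ} {a : CubeSym 3} : D.facetHom d a = 1 ↔
    ∀ y, ∃ z, a.lin (D.embed y) - D.embed y = (d : ℤ) • D.embed z := by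
  rw [← Subtype.coe_inj]
  change reduce 5 d (D.facetMatrix a) = 1 ↔ _
  simp only [reduce_eq_one_iff, ← embed_facetMatrix, ← map_sub, ← map_smul,
    D.embed_injective.eq_iff]

theorem signedPerm_eq_one : ∀ (ε : Fin 3 → ℤˣ) (σ : Equiv.Perm (Fin 3)),
    (∀ k, (ε k : ℤ) * (![1, -1, 0] : Fin 3 → ℤ) (σ.symm k) = (![1, -1, 0] : Fin 3 → ℤ) k) ∧
      (∀ k, (ε k : ℤ) * (![0, 1, -1] : Fin 3 → ℤ) (σ.symm k) = (![0, 1, -1] : Fin 3 → ℤ) k) →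
    ε = 1 ∧ σ = 1 := by
  decide +kernel

theorem sign_mul_eq_of_facetHom_eq_one {d : ℕ} (hd : 2 < d) {a : CubeSym 3}
    (ha : D.facetHom d a = 1) {y : Fin 5 → ℤ} {x : Fin 3 → ℤ} (hy : D.embed y = (0, x, 0))
    (hx : ∀ k, |x k| ≤ 1) (k : Fin 3) : a.ε k * x (a.σ.symm k) = x k := by
  obtain ⟨z, hz⟩ := D.facetHom_eq_one_iff.1 ha y
  have hdvd : (d : ℤ) ∣ a.ε k * x (a.σ.symm k) - x k :=
    ⟨(D.embed z).2.1 k, by simpa [hy, lin] using congrFun (congrArg (·.2.1) hz) k⟩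
  have habs : |a.ε k * x (a.σ.symm k)| ≤ 1 := by
    rw [abs_mul, Int.isUnit_iff_abs_eq.1 (a.ε k).isUnit, one_mul]
    exact hx _
  refine sub_eq_zero.1 (Int.eq_zero_of_abs_lt_dvd hdvd ?_)
  linarith [abs_sub (a.ε k * x (a.σ.symm k)) (x k), hx k, (by exact_mod_cast hd : (2 : ℤ) < d)]

theorem eq_trans_of_facetHom_eq_one {d : ℕ} (hd : 2 < d) {a : CubeSym 3}
    (ha : D.facetHom d a = 1) : a = CubeSym.trans a.v := by
  have h₁ : D.embed (Pi.single 1 1) = (0, ![1, -1, 0], 0) := by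
    rw [embed_eq_iff]
    simp
  have h₂ : D.embed (Pi.single 2 1) = (0, ![0, 1, -1], 0) := by
    rw [embed_eq_iff]
    simp
  obtain ⟨hε, hσ⟩ := signedPerm_eq_one a.ε a.σ
    ⟨D.sign_mul_eq_of_facetHom_eq_one hd ha h₁ (by decide),
      D.sign_mul_eq_of_facetHom_eq_one hd ha h₂ (by decide)⟩
  exact CubeSym.ext rfl hε hσ

theorem dvd_sum_of_facetHom_trans_eq_one {d : ℕ} (hd : d ≠ 0) {v : Fin 3 → ℤ}
    (hv : D.facetHom d (CubeSym.trans v) = 1) (htail : D.tailScale = 2) {y : Fin 5 → ℤ}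
    {α : ℤ} {x : Fin 3 → ℤ} (hy : D.embed y = (α, x, 0)) : (d : ℤ) ∣ ∑ k, v k * x k := by
  have hd' : (d : ℤ) ≠ 0 := Nat.cast_ne_zero.2 hd
  obtain ⟨z, hz⟩ := D.facetHom_eq_one_iff.1 hv y
  simp only [lin_trans_sub, hy, zero_mul, zero_sub, zero_smul, neg_zero, Prod.ext_iff,
    Prod.smul_fst, Prod.smul_snd, smul_eq_mul] at hz
  have hzero : (D.embed z).2.1 = 0 := (smul_eq_zero_iff_right hd').1 hz.2.1.symm
  obtain ⟨w, hw⟩ := (D.exists_embed_eq_iff.1 ⟨z, rfl⟩).2.1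
  simp only [hzero, Pi.zero_apply, Finset.sum_const_zero, add_zero, htail] at hw
  refine ⟨-w, ?_⟩
  rw [hw] at hz
  linarith [hz.1]

theorem exists_tailScale_mul_eq_of_facetHom_trans_eq_one {d : ℕ} {v : Fin 3 → ℤ}
    (hv : D.facetHom d (CubeSym.trans v) = 1) :
    ∃ z, ∀ k, D.tailScale * v k = -(d * (D.embed z).2.1 k) := by
  obtain ⟨z, hz⟩ := D.facetHom_eq_one_iff.1 hv (Pi.single 4 1)
  refine ⟨z, fun k => ?_⟩
  rw [lin_trans_sub] at hz
  have hk : -(D.tailScale * 1 * v k) = d * (D.embed z).2.1 k := congrFun (congrArg (·.2.1) hz) k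
  linarith

theorem dvd_of_facetHom_trans_eq_one {d : ℕ} (hd : d ≠ 0) {v : Fin 3 → ℤ}
    (hv : D.facetHom d (CubeSym.trans v) = 1) (k : Fin 3) : (d : ℤ) ∣ v k := by
  obtain ⟨z, hz⟩ := D.exists_tailScale_mul_eq_of_facetHom_trans_eq_one hv
  obtain htail | htail : D.tailScale = 1 ∨ D.tailScale = 2 := by cases D <;> decide
  · exact ⟨-(D.embed z).2.1 k, by linarith [htail ▸ hz k]⟩
  have hdvd {y : Fin 5 → ℤ} {α : ℤ} {x : Fin 3 → ℤ} (hy : D.embed y = (α, x, 0)) :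
      (d : ℤ) ∣ v 0 * x 0 + v 1 * x 1 + v 2 * x 2 := by
    simpa only [Fin.sum_univ_three] using D.dvd_sum_of_facetHom_trans_eq_one hd hv htail hy
  obtain ⟨a, ha⟩ := hdvd (D.embed_eq_iff.2 (by simp) :
    D.embed (Pi.single 0 1) = (D.headScale, ![-D.headScale, 0, 0], 0))
  obtain ⟨b, hb⟩ := hdvd (D.embed_eq_iff.2 (by simp) :
    D.embed (Pi.single 1 1) = (0, ![1, -1, 0], 0))
  obtain ⟨c, hc⟩ := hdvd (D.embed_eq_iff.2 (by simp) :
    D.embed (Pi.single 2 1) = (0, ![0, 1, -1], 0))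
  simp only [cons_val_zero, cons_val_one, cons_val] at ha hb hc
  obtain ⟨t, ht⟩ : (d : ℤ) ∣ v 0 := by
    obtain hhead | hhead : D.headScale = 1 ∨ D.headScale = 2 := by cases D <;> decide
    · exact ⟨-a, by linarith [hhead ▸ ha]⟩
    · obtain ⟨hfst, hsnd, -⟩ := D.exists_embed_eq_iff.1 ⟨z, rfl⟩
      rw [htail] at hsnd
      rw [hhead] at hfst ha
      obtain ⟨w, hw⟩ := (dvd_add_right hfst).1 hsnd
      have hsum : v 0 + v 1 + v 2 = -(d * w) := by
        rw [Fin.sum_univ_three] at hw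
        simp only [htail] at hz
        apply mul_left_cancel₀ (two_ne_zero (α := ℤ))
        linear_combination hz 0 + hz 1 + hz 2 - d * hw
      exact ⟨2 * b + c - w + a, by linarith⟩
  have h₁ : (d : ℤ) ∣ v 1 := ⟨t - b, by linarith⟩
  have h₂ : (d : ℤ) ∣ v 2 := ⟨t - b - c, by linarith⟩
  fin_cases k
  exacts [⟨t, ht⟩, h₁, h₂]

theorem facetHom_trans_smul_eq_one_iff {d : ℕ} (hd : d ≠ 0) (c : Fin 3 → ℤ) :
    D.facetHom d (CubeSym.trans ((d : ℤ) • c)) = 1 ↔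
      D.headScale ∣ D.tailScale * ∑ k, (d * c k ^ 2 + c k) := by
  have hd' : (d : ℤ) ≠ 0 := Nat.cast_ne_zero.2 hd
  simp only [facetHom_eq_one_iff, lin_trans_smul_sub, (smul_right_injective _ hd').eq_iff,
    eq_comm (b := D.embed _), exists_embed_eq_iff]
  constructor
  · intro h
    have hzero : ∀ k, (![0, 0, 0] : Fin 3 → ℤ) k = 0 := by decide
    simpa [embed, hzero] using (h (Pi.single 4 1)).1
  · intro h y
    have hy : (D.embed y).2.2 = D.tailScale * y 4 := rfl
    rw [hy]
    refine ⟨dvd_sub ?_ (dvd_mul_of_dvd_left D.headScale_dvd_two _),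
      dvd_add (dvd_sub ?_ (dvd_mul_of_dvd_left D.tailScale_dvd_two _)) ?_, dvd_zero _⟩
    · rw [mul_right_comm]
      exact dvd_mul_of_dvd_left h _
    · rw [mul_assoc]
      exact dvd_mul_right _ _
    · refine Finset.dvd_sum fun k _ => dvd_neg.2 ?_
      rw [Pi.smul_apply, smul_eq_mul, mul_assoc]
      exact dvd_mul_right _ _

end BasicSystem

/-! ### The type lattices -/

theorem mem_typeLattice_smul {m : ℕ} {d : ℤ} {q v : Fin m → ℤ} :
    v ∈ typeLattice (d • q) ↔ ∃ c ∈ typeLattice q, v = d • c := by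
  have hmap : typeLattice (d • q) =
      (typeLattice q).map (DistribSMul.toAddMonoidHom (Fin m → ℤ) d) := by
    rw [typeLattice, typeLattice, AddMonoidHom.map_closure]
    congr 1
    ext x
    constructor
    · rintro ⟨σ, ε, rfl⟩
      exact ⟨_, ⟨σ, ε, rfl⟩, funext fun i => mul_left_comm _ _ _⟩
    · rintro ⟨_, ⟨σ, ε, rfl⟩, rfl⟩
      exact ⟨σ, ε, funext fun i => mul_left_comm _ _ _⟩
  rw [hmap, AddSubgroup.mem_map]
  exact exists_congr fun c => and_congr_right fun _ => eq_comm

theorem typeLattice_single_one {m : ℕ} (i : Fin m) : typeLattice (Pi.single i 1) = ⊤ := by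
  refine eq_top_iff.2 fun v _ => ?_
  have hsingle (j : Fin m) : Pi.single j 1 ∈ typeLattice (Pi.single i (1 : ℤ)) := by
    refine AddSubgroup.subset_closure ⟨Equiv.swap i j, 1, ?_⟩
    ext k
    simp [Pi.single_apply, Equiv.swap_apply_eq_iff]
  rw [← Finset.univ_sum_single v]
  refine sum_mem fun j _ => ?_
  have hmem := zsmul_mem (hsingle j) (v j)
  rwa [← Pi.single_smul, smul_eq_mul, mul_one] at hmem

theorem even_sum_of_mem_typeLattice {m : ℕ} {q c : Fin m → ℤ} (hq : Even (∑ k, q k))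
    (hc : c ∈ typeLattice q) : Even (∑ k, c k) := by
  induction hc using AddSubgroup.closure_induction with
  | mem x hx =>
    obtain ⟨σ, ε, rfl⟩ := hx
    rw [← Equiv.sum_comp σ] at hq
    refine (Int.even_sub.1 ?_).2 hq
    rw [← Finset.sum_sub_distrib]
    refine Finset.even_sum _ fun k _ => ?_
    rcases Int.units_eq_one_or (ε k) with hε | hε <;> simp [hε, Int.even_sub]
  | zero => simp
  | add x y _ _ hx hy => simpa only [Pi.add_apply, Finset.sum_add_distrib] using hx.add hy
  | neg x _ hx => simpa only [Pi.neg_apply, Finset.sum_neg_distrib] using hx.neg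

theorem mem_typeLattice_one_one_zero {c : Fin 3 → ℤ} :
    c ∈ typeLattice ![1, 1, 0] ↔ Even (∑ k, c k) := by
  refine ⟨even_sum_of_mem_typeLattice (by decide), ?_⟩
  rw [Fin.sum_univ_three]
  rintro ⟨s, hs⟩
  have h₁ : ![1, -1, 0] ∈ typeLattice ![1, 1, 0] :=
    AddSubgroup.subset_closure ⟨1, ![1, -1, 1], by decide +kernel⟩
  have h₂ : ![0, 1, -1] ∈ typeLattice ![1, 1, 0] :=
    AddSubgroup.subset_closure ⟨Equiv.swap 0 2, ![1, 1, -1], by decide +kernel⟩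
  have h₃ : ![0, 1, 1] ∈ typeLattice ![1, 1, 0] :=
    AddSubgroup.subset_closure ⟨Equiv.swap 0 2, 1, by decide +kernel⟩
  have hsum : c = c 0 • ![1, -1, 0] + (c 0 + c 1 - s) • ![0, 1, -1] + s • ![0, 1, 1] := by
    ext k
    fin_cases k <;> simp
    · ring
    · linear_combination hs
  rw [hsum]
  exact add_mem (add_mem (zsmul_mem h₁ _) (zsmul_mem h₂ _)) (zsmul_mem h₃ _)

namespace BasicSystem

open Matrix CubeSym modGroup

variable (D : BasicSystem)

theorem mem_typeLattice_typeVector {d : ℕ} {v : Fin 3 → ℤ} : v ∈ typeLattice (D.typeVector d) ↔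
    ∃ c : Fin 3 → ℤ, (D = .d ∧ Even d → Even (∑ k, c k)) ∧ v = (d : ℤ) • c := by
  by_cases h : D = .d ∧ Even d
  · have hvec : (![d, d, 0] : Fin 3 → ℤ) = (d : ℤ) • ![1, 1, 0] := by simp
    rw [typeVector, if_pos h, hvec, mem_typeLattice_smul]
    simp only [mem_typeLattice_one_one_zero, h, and_self, forall_const]
  · have hvec : (![d, 0, 0] : Fin 3 → ℤ) = (d : ℤ) • Pi.single 0 1 := by
      ext k
      fin_cases k <;> simp
    rw [typeVector, if_neg h, hvec, mem_typeLattice_smul]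
    simp only [typeLattice_single_one, AddSubgroup.mem_top, h, false_imp_iff, true_and]

theorem headScale_dvd_iff (d : ℕ) (c : Fin 3 → ℤ) :
    D.headScale ∣ D.tailScale * ∑ k, (d * c k ^ 2 + c k) ↔
      (D = .d ∧ Even d → Even (∑ k, c k)) := by
  cases D
  case d =>
    rw [headScale, tailScale, one_mul, ← even_iff_two_dvd]
    simp only [Fin.sum_univ_three, parity_simps, Int.even_coe_nat]
    tauto
  all_goals simp [headScale, tailScale]

theorem facetHom_eq_one_iff_mem_typeLattice {d : ℕ} (hd : 2 < d) (a : CubeSym 3) :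
    D.facetHom d a = 1 ↔ ∃ v ∈ typeLattice (D.typeVector d), a = CubeSym.trans v := by
  simp only [mem_typeLattice_typeVector, ← headScale_dvd_iff,
    ← D.facetHom_trans_smul_eq_one_iff (by omega : d ≠ 0)]
  constructor
  · intro ha
    have htrans := D.eq_trans_of_facetHom_eq_one hd ha
    rw [htrans] at ha
    choose c hc using D.dvd_of_facetHom_trans_eq_one (by omega) ha
    have hv : a.v = (d : ℤ) • c := funext hc
    exact ⟨a.v, ⟨c, hv ▸ ha, hv⟩, htrans⟩
  · rintro ⟨v, ⟨c, hc, rfl⟩, rfl⟩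
    exact hc

/-! ### Conjugacy for odd moduli -/

/-- The diagonal matrix that conjugates the reflections of `D` to those of the system `b`. -/
def scaling : Matrix (Fin 5) (Fin 5) ℤ :=
  diagonal ![D.headScale, 1, 1, D.tailScale, D.tailScale]

theorem scaling_mul_reflMatrix (i : Fin 5) :
    D.scaling * reflMatrix D.labels i = reflMatrix (labels .b) i * D.scaling := by
  revert i
  cases D <;> decide +kernel

theorem isUnit_det_scaling {d : ℕ} (hd : Odd d) :
    IsUnit (D.scaling.map (Int.cast : ℤ → ZMod d)).det := by
  have htwo : IsUnit (2 : ZMod d) := by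
    exact_mod_cast (ZMod.isUnit_iff_coprime 2 d).2 (Nat.coprime_two_left.2 hd)
  have hunit {z : ℤ} (hz : z ∣ 2) : IsUnit (z : ZMod d) :=
    isUnit_of_dvd_unit (by simpa using map_dvd (Int.castRingHom (ZMod d)) hz) htwo
  rw [scaling, diagonal_map Int.cast_zero, det_diagonal, Fin.prod_univ_five]
  simpa using ((hunit D.headScale_dvd_two).mul (hunit D.tailScale_dvd_two)).mul
    (hunit D.tailScale_dvd_two)

/-- The scaling matrix over the integers modulo an odd number. -/
noncomputable def scalingUnit {d : ℕ} (hd : Odd d) : GeneralLinearGroup (Fin 5) (ZMod d) :=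
  GeneralLinearGroup.mk'' _ (D.isUnit_det_scaling hd)

theorem scalingUnit_mul {d : ℕ} (hd : Odd d) (i : Fin 5) :
    D.scalingUnit hd * modGen D.labels d i = modGen (labels .b) d i * D.scalingUnit hd := by
  apply Units.ext
  have h := congrArg (fun M => M.map (Int.castRingHom (ZMod d))) (D.scaling_mul_reflMatrix i)
  simp only [Matrix.map_mul] at h
  exact h

theorem exists_conj_modGen_eq {d : ℕ} (hd : Odd d) (D' : BasicSystem) :
    ∃ h : GeneralLinearGroup (Fin 5) (ZMod d), ∀ i,
      h * modGen D.labels d i * h⁻¹ = modGen D'.labels d i := by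
  refine ⟨(D'.scalingUnit hd)⁻¹ * D.scalingUnit hd, fun i => ?_⟩
  rw [mul_inv_eq_iff_eq_mul, mul_assoc, D.scalingUnit_mul hd, inv_mul_eq_iff_eq_mul, ← mul_assoc,
    ← mul_assoc, D'.scalingUnit_mul hd, mul_assoc _ _ (_⁻¹), mul_inv_cancel, mul_one]

end BasicSystem

namespace modGroup

open Matrix

variable {n d : ℕ} {a b : Fin n → ℕ} {h : GeneralLinearGroup (Fin n) (ZMod d)}

theorem map_conj (hh : ∀ i, h * modGen a d i * h⁻¹ = modGen b d i) :
    (modGroup a d).map (MulAut.conj h).toMonoidHom = modGroup b d := by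
  simp only [modGroup, linGroup, MonoidHom.map_closure, ← Set.range_comp]
  exact congrArg (fun f => Subgroup.closure (Set.range f)) (funext hh)

/-- Conjugation by `h` as an isomorphism between two modular groups whose generators it matches. -/
noncomputable def conjEquiv (hh : ∀ i, h * modGen a d i * h⁻¹ = modGen b d i) :
    modGroup a d ≃* modGroup b d :=
  ((MulAut.conj h).subgroupMap (modGroup a d)).trans (MulEquiv.subgroupCongr (map_conj hh))

end modGroup

theorem CosetFace.finite {n : ℕ} {Γ : Type*} [Group Γ] [Finite Γ] (ρ : Fin n → Γ) :
    Finite (CosetFace ρ) :=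
  Finite.of_surjective (fun p : Fin (n + 2) × Γ => (⟨p.1, p.2⟩ : CosetFace ρ)) fun F => by
    obtain ⟨j, c⟩ := F
    obtain ⟨g, rfl⟩ := QuotientGroup.mk_surjective c
    exact ⟨(j, g), rfl⟩

theorem mainTheorem6 (d : ℕ) (hd : 2 < d) :
    (∀ D : BasicSystem,
      IsStringCGroup (modGen D.labels d) ∧
      Finite (CosetFace (modGen D.labels d)) ∧
      IsRegularPolytope 5 (CosetFace (modGen D.labels d)) CosetFace.rk ∧
      (∃ φ : modGroup D.labels d ≃*
          (CosetFace (modGen D.labels d) ≃o CosetFace (modGen D.labels d)),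
        ∀ (g : modGroup D.labels d) (j : Fin 7) (x : modGroup D.labels d),
          φ g ⟨j, (x : modGroup D.labels d ⧸ faceSubgroup (modGen D.labels d) j)⟩ =
            ⟨j, ((g * x : modGroup D.labels d) :
              modGroup D.labels d ⧸ faceSubgroup (modGen D.labels d) j)⟩) ∧
      HasFacetsAndVertexFigures 5 (CosetFace (modGen D.labels d)) CosetFace.rk
        (CubicToroid (D.typeVector d)) Cell24) ∧
    (Odd d → ∀ D D' : BasicSystem,
      ∃ (h : Matrix.GeneralLinearGroup (Fin 5) (ZMod d))
        (φ : modGroup D.labels d ≃* modGroup D'.labels d),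
        (∀ g : modGroup D.labels d,
          (φ g : Matrix.GeneralLinearGroup (Fin 5) (ZMod d)) = h * g * h⁻¹) ∧
        ∀ i : Fin 5, φ (modGen D.labels d i) = modGen D'.labels d i) := by
  refine ⟨fun D => ?_, fun hodd D D' => ?_⟩
  · have hρ := D.isStringCGroup hd
    have hF₄ : Subgroup.closure (Set.range CoxeterMatrix.F₄.simple) = ⊤ := by
      simpa using CoxeterMatrix.F₄.toCoxeterSystem.subgroup_closure_range_simple
    have : NeZero d := ⟨by omega⟩
    refine ⟨hρ, CosetFace.finite _, hρ.isRegularPolytope, ⟨hρ.automorphismEquiv, fun _ _ _ => rfl⟩,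
      fun F hF => ?_, fun F hF => ?_⟩
    · exact hρ.nonempty_facet_iso (D.facetHom_gen d) (D.facetHom_eq_one_iff_mem_typeLattice hd)
        (by rw [hF]; norm_num)
    · exact hρ.nonempty_vertexFigure_iso (D.vertexHom_simple d) hF₄ (D.vertexHom_injective hd) hF
  · obtain ⟨h, hh⟩ := D.exists_conj_modGen_eq hodd D'
    exact ⟨h, modGroup.conjEquiv hh, fun _ => rfl, fun i => Subtype.ext (hh i)⟩
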